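/- **Theorem (regret of ROFUL under linked convex constraints).** Let $d\ge 2$, $n\ge 1$, $T\ge 1$ be integers. Write $\mathbb B$ for the closed Euclidean unit ball of $\mathbb R^n$, $\mathbb B_\infty$ for the closed unit ball of the sup norm of $\mathbb R^n$, $\|\cdot\|$ for Euclidean norms, and $\|x\|_M=\sqrt{x^\top M x}$. *Setting.* Let $\mathcal X\subseteq\mathbb R^d$ be closed and star-convex about $0$, with $\|x\|\le 1$ for all $x\in\mathcal X$. Let $\mathcal G\subseteq\mathbb R^n$ be convex with $r\mathbb B\subseteq\mathcal G$ for some $r>0$. Let $\theta\in\mathbb R^d$ and $A\in\mathbb R^{n\times d}$ (unknown to the learner) have $\|\theta\|\le S_\theta$ and all rows of $A$ of norm at most $S_A$, where $S_\theta,S_A>0$; put $S=\max(S_A,S_\theta)$ and $\nu=\frac{r}{\sqrt n\,S_A}$, and assume $\nu\le 1$. Suppose that $\theta^\top x$ attains its maximum over the feasible set $\{x\in\mathcal X: Ax\in\mathcal G\}$ at a point $x_*$, and that $\theta^\top x_*>0$. In round $t=1,\dots,T$ the learner plays a random vector $x_t\in\mathcal X$ and observes $y_t=\theta^\top x_t+\epsilon_t$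 and $z_t=Ax_t+\eta_t\in\mathbb R^n$. With some $\rho\ge 0$, the noise satisfies, for all $t\in\{1,\dots,T\}$, $$\mathbb E[\epsilon_t\mid x_1,\epsilon_1,\dots,x_{t-1},\epsilon_{t-1},x_t]=0,\qquad \mathbb E[e^{s\epsilon_t}\mid x_1,\epsilon_1,\dots,x_{t-1},\epsilon_{t-1},x_t]\le e^{s^2\rho^2/2}\quad\text{for all } s\in\mathbb R,$$ and for each $i\in\{1,\dots,n\}$ the same holds with $\epsilon_1,\dots,\epsilon_t$ replaced by the $i$-th coordinates $\eta_{1,i},\dots,\eta_{t,i}$. *Algorithm (ROFUL with box-shaped uncertainty sets).* Let $\delta\in(0,1)$ and $\lambda\ge 1$. In round $t$ set $$V_t=\lambda I+\sum_{k=1}^{t-1}x_kx_k^\top,\qquad \hat\theta_t=V_t^{-1}\sum_{k=1}^{t-1}x_ky_k,\qquad \hat a_{t,i}=V_t^{-1}\sum_{k=1}^{t-1}x_kz_{k,i},\qquad \hat A_t=[\hat a_{t,1}\,\cdots\,\hat a_{t,n}]^\top,$$ $$\beta_t=\rho\sqrt{d\log\left(\frac{1+(t-1)/\lambda}{\delta/(n+1)}\right)}+\sqrt\lambda\,S,$$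 $$\mathcal Y_t^o=\{x\in\mathcal X:(\hat A_tx+\beta_t\|x\|_{V_t^{-1}}\mathbb B_\infty)\cap\mathcal G\neq\emptyset\},\qquad \mathcal Y_t^p=\{x\in\mathcal X:\hat A_tx+\beta_t\|x\|_{V_t^{-1}}\mathbb B_\infty\subseteq\mathcal G\}.$$ The learner picks any $\tilde x_t\in\arg\max_{x\in\mathcal Y_t^o}\bigl(\hat\theta_t^\top x+\beta_t\|x\|_{V_t^{-1}}\bigr)$, sets $\mu_t=\max\{\mu\in[0,1]:\mu\tilde x_t\in\mathcal Y_t^p\}$ and $\gamma_t=\max\bigl(\min(\nu/\|\tilde x_t\|,1),\mu_t\bigr)$, and plays $x_t=\gamma_t\tilde x_t$. (These maxima are assumed to be attained, as they are whenever $\mathcal G$ is closed; if $\tilde x_t=0$ then $x_t=0$.) *Conclusion.* With probability at least $1-\delta$, $$\sum_{t=1}^T\theta^\top(x_*-x_t)\;\le\;\frac{2\sqrt n}{r}\,(S_\theta+S_A)\,\beta_T\sqrt{2dT\log\left(1+\frac{T}{\lambda d}\right)}.$$ -/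

import Mathlib

open MeasureTheory
open scoped Matrix

noncomputable section

/-- Column vectors `ℝ^m` with the Euclidean norm. -/
abbrev Vec (m : ℕ) : Type := EuclideanSpace ℝ (Fin m)

/-- The matrix-vector product `M x`. -/
def matVec {m d : ℕ} (M : Matrix (Fin m) (Fin d) ℝ) (x : Vec d) : Vec m :=
  WithLp.toLp 2 (M *ᵥ x.ofLp)

/-- The `i`-th row of `M`, as a vector. -/
def rowVec {m d : ℕ} (M : Matrix (Fin m) (Fin d) ℝ) (i : Fin m) : Vec d :=
  WithLp.toLp 2 (M i)

/-- The weighted norm `‖x‖_M = √(xᵀ M x)`. -/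
def weightedNorm {d : ℕ} (M : Matrix (Fin d) (Fin d) ℝ) (x : Vec d) : ℝ :=
  Real.sqrt (x.ofLp ⬝ᵥ M *ᵥ x.ofLp)

/-- The unit ball of the sup norm. -/
def supBall (m : ℕ) : Set (Vec m) := {v | ∀ i, |v i| ≤ 1}

/-- The box `c + s 𝔹_∞`. -/
def box {m : ℕ} (c : Vec m) (s : ℝ) : Set (Vec m) :=
  {w | ∃ v ∈ supBall m, w = c + s • v}

/-- What the learner knows: the action set, the constraint set, the radius of a ball inside the
constraint set, bounds on the rows of the constraint matrix and on the reward vector, the noise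
level, the regularization parameter and the failure probability. -/
structure LearnerInput (d n : ℕ) where
  actions : Set (Vec d)
  G : Set (Vec n)
  r : ℝ
  SA : ℝ
  Stheta : ℝ
  rho : ℝ
  lam : ℝ
  delta : ℝ

namespace LearnerInput

variable {d n : ℕ} (I : LearnerInput d n)

/-- `ν = r / (√n S_A)`. -/
def nu : ℝ := I.r / (Real.sqrt n * I.SA)

/-- `S = max(S_A, S_θ)`. -/
def S : ℝ := max I.SA I.Stheta

/-- The confidence radius
`β_t = ρ √(d log((1 + (t-1)/λ) / (δ/(n+1)))) + √λ S`, for rounds `t ≥ 1`. -/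
def beta (t : ℕ) : ℝ :=
  I.rho * Real.sqrt (d * Real.log ((1 + ((t : ℝ) - 1) / I.lam) / (I.delta / ((n : ℝ) + 1))))
    + Real.sqrt I.lam * I.S

/-- `V_t = ∑_{k=1}^{t-1} x_k x_kᵀ + λ I`. -/
def gram (x : ℕ → Vec d) (t : ℕ) : Matrix (Fin d) (Fin d) ℝ :=
  ∑ k ∈ Finset.Ico 1 t, Matrix.vecMulVec (x k).ofLp (x k).ofLp + I.lam • 1

/-- The regularized least-squares estimator `V_t⁻¹ ∑_{k=1}^{t-1} x_k y_k`. -/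
def estimator (x : ℕ → Vec d) (y : ℕ → ℝ) (t : ℕ) : Vec d :=
  matVec (I.gram x t)⁻¹ (∑ k ∈ Finset.Ico 1 t, y k • x k)

/-- The estimator of the constraint matrix: its `i`-th row is the estimator computed from the
`i`-th coordinates of the constraint observations. -/
def matEstimator (x : ℕ → Vec d) (z : ℕ → Vec n) (t : ℕ) : Matrix (Fin n) (Fin d) ℝ :=
  Matrix.of fun i => (I.estimator x (fun k => z k i) t).ofLp

/-- The confidence width `β_t ‖v‖_{V_t⁻¹}` of the point `v`. -/
def width (x : ℕ → Vec d) (t : ℕ) (v : Vec d) : ℝ :=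
  I.beta t * weightedNorm (I.gram x t)⁻¹ v

/-- The box-shaped uncertainty set `Â_t v + β_t ‖v‖_{V_t⁻¹} 𝔹_∞` for the value `A v`. -/
def uncertaintySet (x : ℕ → Vec d) (z : ℕ → Vec n) (t : ℕ) (v : Vec d) : Set (Vec n) :=
  box (matVec (I.matEstimator x z t) v) (I.width x t v)

/-- The optimistic action set. -/
def optimisticSet (x : ℕ → Vec d) (z : ℕ → Vec n) (t : ℕ) : Set (Vec d) :=
  {v | v ∈ I.actions ∧ (I.uncertaintySet x z t v ∩ I.G).Nonempty}

/-- The pessimistic action set. -/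
def pessimisticSet (x : ℕ → Vec d) (z : ℕ → Vec n) (t : ℕ) : Set (Vec d) :=
  {v | v ∈ I.actions ∧ I.uncertaintySet x z t v ⊆ I.G}

/-- The upper confidence bound `θ̂_tᵀ v + β_t ‖v‖_{V_t⁻¹}` on the reward of `v`. -/
def ucb (x : ℕ → Vec d) (y : ℕ → ℝ) (t : ℕ) (v : Vec d) : ℝ :=
  inner ℝ (I.estimator x y t) v + I.width x t v

/-- In round `t`, having seen `x_k, y_k, z_k` for `1 ≤ k < t`, the algorithm ROFUL plays `x_t`:
it picks any maximizer `xt` of the upper confidence bound over the optimistic set, finds the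
largest scaling `μ ∈ [0,1]` that brings `xt` into the pessimistic set, and plays `xt` scaled by
`max (min (ν / ‖xt‖) 1) μ`. (For `xt = 0` the scaling is
immaterial.) -/
def ROFULRound (x : ℕ → Vec d) (y : ℕ → ℝ) (z : ℕ → Vec n) (t : ℕ) : Prop :=
  ∃ (xt : Vec d) (μ : ℝ),
    (xt ∈ I.optimisticSet x z t ∧ ∀ v ∈ I.optimisticSet x z t, I.ucb x y t v ≤ I.ucb x y t xt) ∧
    IsGreatest {m : ℝ | m ∈ Set.Icc (0 : ℝ) 1 ∧ m • xt ∈ I.pessimisticSet x z t} μ ∧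
    x t = max (min (I.nu / ‖xt‖) 1) μ • xt

end LearnerInput

/-- The σ-algebra generated by `x_1, e_1, …, x_{t-1}, e_{t-1}, x_t`. -/
abbrev history {Ω : Type*} {d : ℕ} (x : ℕ → Ω → Vec d) (e : ℕ → Ω → ℝ) (t : ℕ) :
    MeasurableSpace Ω :=
  (⨆ k ∈ Finset.Icc 1 t, MeasurableSpace.comap (x k) inferInstance) ⊔
    ⨆ k ∈ Finset.Ico 1 t, MeasurableSpace.comap (e k) inferInstance

/-- In rounds `1, …, T` the noise `e_t` has conditional mean zero and is conditionally
`ρ`-subgaussian given `x_1, e_1, …, e_{t-1}, x_t`. The two integrability clauses only make sure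
that the conditional expectations are genuine ones. -/
structure CondSubgaussianNoise {Ω : Type*} [MeasurableSpace Ω] {d : ℕ} (P : Measure Ω)
    (x : ℕ → Ω → Vec d) (e : ℕ → Ω → ℝ) (ρ : ℝ) (T : ℕ) : Prop where
  measurable : ∀ t ∈ Finset.Icc 1 T, Measurable (e t)
  integrable : ∀ t ∈ Finset.Icc 1 T, Integrable (e t) P
  integrable_exp : ∀ t ∈ Finset.Icc 1 T, ∀ s : ℝ, Integrable (fun ω => Real.exp (s * e t ω)) P
  condMean : ∀ t ∈ Finset.Icc 1 T, ∀ᵐ ω ∂P, (P[e t | history x e t]) ω = 0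
  condMGF : ∀ t ∈ Finset.Icc 1 T, ∀ s : ℝ,
    ∀ᵐ ω ∂P, (P[fun ω' => Real.exp (s * e t ω') | history x e t]) ω
      ≤ Real.exp (s ^ 2 * ρ ^ 2 / 2)

end

/-! Regret splits into a statistical part and a geometric part.

Statistically, let `b_t` be the noise sum and `M_t = (det V_t / λ^d)^(-1/2) exp(‖b_t‖²_{V_t⁻¹} /
2ρ²)`. The rank-one formulas for inverse and determinant reduce one step of `M` to a scalar
inequality, which follows by mixing the sub-Gaussian bound over a Gaussian parameter. So `M` is a
supermartingale, and a maximal inequality bounds `‖b_t‖_{V_t⁻¹}` in all rounds at once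
(`measure_noiseSum_gt_le`). A union bound over the reward and the `n` rows of `A` gives confidence
sets with half-width `β_t ‖v‖_{V_t⁻¹}` at each `v` (`abs_inner_estimator_sub_le`).

Geometrically, let `W` be the width at the optimistic point `x̃_t`. Optimism gives `θᵀ(x_* - x̃_t) ≤
2W`. Scaling costs `(1 - γ) θᵀx̃_t`, and convexity of `G` around the ball of radius `r` shows that
the factor `r / (r + 2√n W)` already makes `x̃_t` pessimistically safe, so `1 - γ ≤ (2√n/r) γW`
(`box_smul_subset`). As `γ ≥ ν` unless `x̃_t = 0`, also `2W ≤ (2√n S_A/r) γW`. Since `γW` is the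
width at the action actually played, both terms are summable by Cauchy-Schwarz and the elliptical
potential bound (`sum_weightedNorm_sq_le`). -/

/-! ### Positive definite matrices: inverses, rank-one updates, determinants. -/

namespace Matrix

variable {ι : Type*} [Fintype ι] [DecidableEq ι] {V : Matrix ι ι ℝ}

lemma PosDef.dotProduct_inv_mulVec_comm (hV : V.PosDef) (a b : ι → ℝ) :
    a ⬝ᵥ V⁻¹ *ᵥ b = b ⬝ᵥ V⁻¹ *ᵥ a := by
  have h : (V⁻¹)ᵀ = V⁻¹ := by simpa using hV.inv.isHermitian.eq
  rw [dotProduct_mulVec, ← mulVec_transpose, h, dotProduct_comm]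

lemma PosDef.dotProduct_inv_mulVec_nonneg (hV : V.PosDef) (a : ι → ℝ) :
    0 ≤ a ⬝ᵥ V⁻¹ *ᵥ a := by
  simpa using hV.inv.posSemidef.dotProduct_mulVec_nonneg a

lemma PosDef.sq_dotProduct_inv_mulVec_le (hV : V.PosDef) (a b : ι → ℝ) :
    (a ⬝ᵥ V⁻¹ *ᵥ b) ^ 2 ≤ (a ⬝ᵥ V⁻¹ *ᵥ a) * (b ⬝ᵥ V⁻¹ *ᵥ b) := by
  have h := LinearMap.BilinForm.apply_mul_apply_le_of_forall_zero_le
    (Matrix.toBilin' V⁻¹) (fun x => by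
      simpa [Matrix.toBilin'_apply'] using hV.dotProduct_inv_mulVec_nonneg x) a b
  simp only [Matrix.toBilin'_apply'] at h
  rwa [hV.dotProduct_inv_mulVec_comm b a, ← sq] at h

lemma PosDef.mulVec_inv_mulVec (hV : V.PosDef) (b : ι → ℝ) : V *ᵥ (V⁻¹ *ᵥ b) = b := by
  rw [mulVec_mulVec, mul_nonsing_inv _ ((isUnit_iff_isUnit_det _).1 hV.isUnit), one_mulVec]

lemma PosDef.inv_mulVec_mulVec (hV : V.PosDef) (b : ι → ℝ) : V⁻¹ *ᵥ (V *ᵥ b) = b := by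
  rw [mulVec_mulVec, nonsing_inv_mul _ ((isUnit_iff_isUnit_det _).1 hV.isUnit), one_mulVec]

lemma posSemidef_vecMulVec_self {ι : Type*} [Fintype ι] (x : ι → ℝ) :
    (vecMulVec x x).PosSemidef := by
  simpa using posSemidef_vecMulVec_self_star x

lemma PosDef.add_vecMulVec {ι : Type*} [Fintype ι] {V : Matrix ι ι ℝ} (hV : V.PosDef) (x : ι → ℝ) :
    (V + vecMulVec x x).PosDef :=
  hV.add_posSemidef (posSemidef_vecMulVec_self x)

/-- The Sherman-Morrison formula, checked by multiplying the candidate back by the updated matrix.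
-/
lemma PosDef.inv_add_vecMulVec_mulVec (hV : V.PosDef) (x b : ι → ℝ) :
    (V + vecMulVec x x)⁻¹ *ᵥ b =
      V⁻¹ *ᵥ b - ((x ⬝ᵥ V⁻¹ *ᵥ b) / (1 + x ⬝ᵥ V⁻¹ *ᵥ x)) • V⁻¹ *ᵥ x := by
  have hu := hV.dotProduct_inv_mulVec_nonneg x
  have h : (V + vecMulVec x x) *ᵥ
      (V⁻¹ *ᵥ b - ((x ⬝ᵥ V⁻¹ *ᵥ b) / (1 + x ⬝ᵥ V⁻¹ *ᵥ x)) • V⁻¹ *ᵥ x) = b := by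
    rw [add_mulVec, mulVec_sub, mulVec_sub, mulVec_smul, mulVec_smul, hV.mulVec_inv_mulVec,
      hV.mulVec_inv_mulVec, vecMulVec_mulVec, vecMulVec_mulVec]
    ext i
    simp
    field_simp
    ring
  conv_lhs => rw [← h]
  rw [(hV.add_vecMulVec x).inv_mulVec_mulVec]

lemma PosDef.det_add_vecMulVec (hV : V.PosDef) (x : ι → ℝ) :
    (V + vecMulVec x x).det = V.det * (1 + x ⬝ᵥ V⁻¹ *ᵥ x) := by
  rw [vecMulVec_eq Unit, det_add_replicateCol_mul_replicateRow (ι := Unit)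
    ((isUnit_iff_isUnit_det _).1 hV.isUnit),
    det_unique (1 + replicateRow Unit x * V⁻¹ * replicateCol Unit x), dotProduct_mulVec]
  simp [Matrix.mul_apply, dotProduct, vecMul]

/-- The effect of a rank-one update on the quadratic form of the inverse. -/
lemma PosDef.dotProduct_inv_add_vecMulVec (hV : V.PosDef) (x b : ι → ℝ) (e : ℝ) :
    (b + e • x) ⬝ᵥ (V + vecMulVec x x)⁻¹ *ᵥ (b + e • x) =
      b ⬝ᵥ V⁻¹ *ᵥ b + (2 * e * (x ⬝ᵥ V⁻¹ *ᵥ b) + e ^ 2 * (x ⬝ᵥ V⁻¹ *ᵥ x)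
        - (x ⬝ᵥ V⁻¹ *ᵥ b) ^ 2) / (1 + x ⬝ᵥ V⁻¹ *ᵥ x) := by
  have hu := hV.dotProduct_inv_mulVec_nonneg x
  rw [hV.inv_add_vecMulVec_mulVec]
  simp only [mulVec_add, mulVec_smul, dotProduct_sub, dotProduct_add, add_dotProduct,
    smul_dotProduct, dotProduct_smul, smul_eq_mul, hV.dotProduct_inv_mulVec_comm b x]
  field_simp
  ring

/-- With `w = V⁻¹ x`, the hypothesis `V ≥ λI` reads `x·w ≥ λ‖w‖²`; expanding `‖λw - x‖² ≥ 0` then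
gives the bound without any spectral calculus. -/
lemma PosDef.dotProduct_inv_mulVec_le_of_le {lam : ℝ} (hlam : 0 < lam) (hV : V.PosDef)
    (h : (V - lam • 1).PosSemidef) (x : ι → ℝ) : x ⬝ᵥ V⁻¹ *ᵥ x ≤ (x ⬝ᵥ x) / lam := by
  set w := V⁻¹ *ᵥ x with hw
  have h1 : 0 ≤ w ⬝ᵥ (V - lam • 1) *ᵥ w := by simpa using h.dotProduct_mulVec_nonneg w
  rw [sub_mulVec, smul_mulVec, one_mulVec, dotProduct_sub, hw, hV.mulVec_inv_mulVec, ← hw,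
    dotProduct_smul, smul_eq_mul, dotProduct_comm w x] at h1
  have h2 : 0 ≤ (lam • w - x) ⬝ᵥ (lam • w - x) := by
    simpa using dotProduct_star_self_nonneg (lam • w - x)
  simp only [sub_dotProduct, dotProduct_sub, smul_dotProduct, dotProduct_smul, smul_eq_mul,
    dotProduct_comm w x] at h2
  rw [le_div_iff₀ hlam]
  nlinarith

/-- The AM-GM inequality for the eigenvalues of a positive semidefinite matrix. -/
lemma PosSemidef.det_le_trace_div_card_pow [Nonempty ι] (hV : V.PosSemidef) :
    V.det ≤ (V.trace / Fintype.card ι) ^ Fintype.card ι := by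
  have hc : (0 : ℝ) < Fintype.card ι := by exact_mod_cast Fintype.card_pos
  have h := Real.geom_mean_le_arith_mean Finset.univ (fun _ : ι => (1 : ℝ))
    hV.isHermitian.eigenvalues (by simp) (by simpa using hc)
    (fun i _ => hV.eigenvalues_nonneg i)
  have h1 : V.det = ∏ i, hV.isHermitian.eigenvalues i := by
    simpa using hV.isHermitian.det_eq_prod_eigenvalues
  have h2 : V.trace = ∑ i, hV.isHermitian.eigenvalues i := by
    simpa using hV.isHermitian.trace_eq_sum_eigenvalues
  simp only [Real.rpow_one, one_mul, Finset.sum_const, Finset.card_univ, nsmul_eq_mul,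
    mul_one] at h
  rw [← h1, ← h2] at h
  have h0 : 0 ≤ V.det := h1 ▸ Finset.prod_nonneg fun i _ => hV.eigenvalues_nonneg i
  calc V.det = (V.det ^ ((Fintype.card ι : ℝ)⁻¹)) ^ Fintype.card ι := by
        rw [Real.rpow_inv_natCast_pow h0 Fintype.card_ne_zero]
    _ ≤ _ := pow_le_pow_left₀ (Real.rpow_nonneg h0 _) h _

end Matrix

/-! ### Weighted norms, Gram matrices and the elliptical potential. -/

lemma weightedNorm_nonneg {d : ℕ} (M : Matrix (Fin d) (Fin d) ℝ) (v : Vec d) :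
    0 ≤ weightedNorm M v := Real.sqrt_nonneg _

lemma weightedNorm_smul {d : ℕ} (M : Matrix (Fin d) (Fin d) ℝ) {c : ℝ} (hc : 0 ≤ c) (v : Vec d) :
    weightedNorm M (c • v) = c * weightedNorm M v := by
  unfold weightedNorm
  rw [← Real.sqrt_sq hc, ← Real.sqrt_mul (sq_nonneg c), Real.sqrt_sq hc]
  congr 1
  simp [Matrix.mulVec_smul, dotProduct_smul, smul_dotProduct]
  ring

lemma abs_dotProduct_inv_mulVec_le {d : ℕ} {V : Matrix (Fin d) (Fin d) ℝ} (hV : V.PosDef)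
    (a b : Vec d) :
    |a.ofLp ⬝ᵥ V⁻¹ *ᵥ b.ofLp| ≤ weightedNorm V⁻¹ a * weightedNorm V⁻¹ b := by
  unfold weightedNorm
  rw [← Real.sqrt_mul (hV.dotProduct_inv_mulVec_nonneg _)]
  exact Real.abs_le_sqrt (hV.sq_dotProduct_inv_mulVec_le _ _)

lemma dotProduct_self_eq_norm_sq {d : ℕ} (v : Vec d) : v.ofLp ⬝ᵥ v.ofLp = ‖v‖ ^ 2 := by
  rw [EuclideanSpace.norm_sq_eq]
  simp [dotProduct, sq]

lemma inner_eq_dotProduct {d : ℕ} (v w : Vec d) : inner ℝ v w = v.ofLp ⬝ᵥ w.ofLp := by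
  rw [EuclideanSpace.inner_eq_star_dotProduct, dotProduct_comm]
  simp

namespace LearnerInput

variable {d n : ℕ} (I : LearnerInput d n)

lemma gram_one (x : ℕ → Vec d) : I.gram x 1 = I.lam • 1 := by simp [gram]

lemma gram_succ (x : ℕ → Vec d) {t : ℕ} (ht : 1 ≤ t) :
    I.gram x (t + 1) = I.gram x t + Matrix.vecMulVec (x t).ofLp (x t).ofLp := by
  simp only [gram, Finset.sum_Ico_succ_top ht]
  abel

lemma posSemidef_gram_sub (x : ℕ → Vec d) (t : ℕ) : (I.gram x t - I.lam • 1).PosSemidef := by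
  rw [gram, add_sub_cancel_right]
  exact Matrix.posSemidef_sum _ fun k _ => Matrix.posSemidef_vecMulVec_self _

lemma posDef_gram (hlam : 0 < I.lam) (x : ℕ → Vec d) (t : ℕ) : (I.gram x t).PosDef := by
  rw [← sub_add_cancel (I.gram x t) (I.lam • 1)]
  exact (Matrix.PosDef.one.smul hlam).posSemidef_add (I.posSemidef_gram_sub x t)

lemma weightedNorm_inv_gram_le (hlam : 0 < I.lam) (x : ℕ → Vec d) (t : ℕ) (v : Vec d) :
    weightedNorm (I.gram x t)⁻¹ v ≤ ‖v‖ / Real.sqrt I.lam := by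
  rw [weightedNorm, ← Real.sqrt_sq (norm_nonneg v), ← Real.sqrt_div (sq_nonneg _),
    ← dotProduct_self_eq_norm_sq]
  exact Real.sqrt_le_sqrt ((I.posDef_gram hlam x t).dotProduct_inv_mulVec_le_of_le hlam
    (I.posSemidef_gram_sub x t) _)

lemma det_gram_one (x : ℕ → Vec d) : (I.gram x 1).det = I.lam ^ d := by
  simp [gram_one]

/-- AM-GM bounds the determinant by the trace, and each action adds at most 1 to the trace. -/
lemma det_gram_le (hd : 0 < d) (hlam : 0 < I.lam) {x : ℕ → Vec d} {t : ℕ} (ht : 1 ≤ t)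
    (hx : ∀ k ∈ Finset.Ico 1 t, ‖x k‖ ≤ 1) :
    (I.gram x t).det ≤ (I.lam * (1 + ((t : ℝ) - 1) / (I.lam * d))) ^ d := by
  have : Nonempty (Fin d) := ⟨⟨0, hd⟩⟩
  have hd' : (0 : ℝ) < d := by exact_mod_cast hd
  have h := (I.posDef_gram hlam x t).posSemidef.det_le_trace_div_card_pow
  rw [Fintype.card_fin] at h
  refine h.trans (pow_le_pow_left₀ ?_ ?_ _)
  · exact div_nonneg (I.posDef_gram hlam x t).posSemidef.trace_nonneg hd'.le
  · have h1 : (I.gram x t).trace ≤ ((t : ℝ) - 1) + I.lam * d := by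
      rw [gram, Matrix.trace_add, Matrix.trace_sum, Matrix.trace_smul, Matrix.trace_one,
        Fintype.card_fin, smul_eq_mul]
      gcongr
      calc ∑ k ∈ Finset.Ico 1 t, (Matrix.vecMulVec (x k).ofLp (x k).ofLp).trace
          ≤ ∑ k ∈ Finset.Ico 1 t, (1 : ℝ) := by
            refine Finset.sum_le_sum fun k hk => ?_
            rw [Matrix.trace_vecMulVec, dotProduct_self_eq_norm_sq]
            exact pow_le_one₀ (norm_nonneg _) (hx k hk)
        _ = (t : ℝ) - 1 := by simp [Nat.cast_sub ht]
    rw [div_le_iff₀ hd']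
    refine h1.trans (le_of_eq ?_)
    field_simp
    ring

lemma det_gram_succ (hlam : 0 < I.lam) (x : ℕ → Vec d) {t : ℕ} (ht : 1 ≤ t) :
    (I.gram x (t + 1)).det = (I.gram x t).det * (1 + weightedNorm (I.gram x t)⁻¹ (x t) ^ 2) := by
  rw [I.gram_succ x ht, (I.posDef_gram hlam x t).det_add_vecMulVec, weightedNorm,
    Real.sq_sqrt ((I.posDef_gram hlam x t).dotProduct_inv_mulVec_nonneg _)]

lemma log_det_gram_le (hd : 0 < d) (hlam : 0 < I.lam) {x : ℕ → Vec d} {t : ℕ} (ht : 1 ≤ t)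
    (hx : ∀ k ∈ Finset.Ico 1 t, ‖x k‖ ≤ 1) :
    Real.log ((I.gram x t).det / I.lam ^ d) ≤
      d * Real.log (1 + ((t : ℝ) - 1) / (I.lam * d)) := by
  rw [← Real.log_pow]
  have h0 := (I.posDef_gram hlam x t).det_pos
  refine Real.log_le_log (by positivity) ?_
  rw [div_le_iff₀ (by positivity), mul_comm, ← mul_pow]
  exact I.det_gram_le hd hlam ht hx

/-- The elliptical potential bound. -/
lemma sum_weightedNorm_sq_le (hd : 0 < d) (hlam : 1 ≤ I.lam) {x : ℕ → Vec d} {T : ℕ}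
    (hx : ∀ k ∈ Finset.Icc 1 T, ‖x k‖ ≤ 1) :
    ∑ t ∈ Finset.Icc 1 T, weightedNorm (I.gram x t)⁻¹ (x t) ^ 2 ≤
      2 * d * Real.log (1 + T / (I.lam * d)) := by
  have hlam0 : 0 < I.lam := by linarith
  -- The factors `1 + ‖x_s‖²_{V_s⁻¹}` are ratios of consecutive determinants, so their logarithms
  -- telescope.
  have key : ∀ t, (∀ k ∈ Finset.Icc 1 t, ‖x k‖ ≤ 1) →
      ∑ s ∈ Finset.Icc 1 t, weightedNorm (I.gram x s)⁻¹ (x s) ^ 2 ≤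
        2 * Real.log ((I.gram x (t + 1)).det / I.lam ^ d) := by
    intro t
    induction t with
    | zero => intro _; simp [det_gram_one, hlam0.ne']
    | succ t ih =>
      intro h
      have ih := ih fun k hk => h k (by simp at hk ⊢; omega)
      have hw : weightedNorm (I.gram x (t + 1))⁻¹ (x (t + 1)) ≤ 1 := by
        refine (I.weightedNorm_inv_gram_le hlam0 x _ _).trans ?_
        rw [div_le_one (Real.sqrt_pos.2 hlam0)]
        exact (h _ (by simp)).trans (Real.one_le_sqrt.2 hlam)
      set u := weightedNorm (I.gram x (t + 1))⁻¹ (x (t + 1)) ^ 2 with hu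
      have hu0 : 0 ≤ u := sq_nonneg _
      have hu1 : u ≤ 1 := pow_le_one₀ (weightedNorm_nonneg _ _) hw
      -- On `[0, 1]`, `log (1 + u) ≥ u / (1 + u) ≥ u / 2`; the assumption `λ ≥ 1` is what keeps `u ≤
      -- 1`.
      have hlog : u ≤ 2 * Real.log (1 + u) := by
        have := Real.one_sub_inv_le_log_of_pos (show 0 < 1 + u by linarith)
        have h2 : 1 - (1 + u)⁻¹ = u / (1 + u) := by field_simp; ring
        have h3 : u / 2 ≤ u / (1 + u) := div_le_div_of_nonneg_left hu0 (by linarith) (by linarith)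
        linarith
      rw [Finset.sum_Icc_succ_top (by omega), I.det_gram_succ hlam0 x (by omega : 1 ≤ t + 1),
        ← hu, mul_div_right_comm, Real.log_mul (by
          have := (I.posDef_gram hlam0 x (t + 1)).det_pos
          positivity) (by positivity)]
      linarith
  refine (key T hx).trans ?_
  have := I.log_det_gram_le hd hlam0 (t := T + 1) (by omega) (x := x)
    (fun k hk => hx k (by simp at hk ⊢; omega))
  push_cast at this
  rw [add_sub_cancel_right] at this
  linarith

end LearnerInput

/-! ### One conditional sub-Gaussian step, by Gaussian mixing. -/

lemma lintegral_exp_quadratic {a : ℝ} (ha : 0 < a) (b c : ℝ) :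
    ∫⁻ g : ℝ, ENNReal.ofReal (Real.exp (-a * g ^ 2 + b * g + c)) =
      ENNReal.ofReal (Real.sqrt (Real.pi / a) * Real.exp (b ^ 2 / (4 * a) + c)) := by
  have h : ∀ g : ℝ, Real.exp (-a * g ^ 2 + b * g + c) =
      Real.exp (-a * (g - b / (2 * a)) ^ 2) * Real.exp (b ^ 2 / (4 * a) + c) := by
    intro g
    rw [← Real.exp_add]
    congr 1
    field_simp
    ring
  have hi : Integrable fun g : ℝ => Real.exp (-a * (g - b / (2 * a)) ^ 2) :=
    (integrable_exp_neg_mul_sq ha).comp_sub_right _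
  simp_rw [h]
  rw [← ofReal_integral_eq_lintegral_ofReal (hi.mul_const _)
    (Filter.Eventually.of_forall fun _ => by positivity), integral_mul_const,
    integral_sub_right_eq_self (fun g : ℝ => Real.exp (-a * g ^ 2)), integral_gaussian]

/-- Mixing the sub-Gaussian bounds over a Gaussian prior on the parameter. -/
lemma lintegral_exp_quadratic_le_of_subgaussian {κ : Measure ℝ} [SFinite κ] {ρ : ℝ} (hρ : 0 < ρ)
    (h : ∀ s : ℝ, ∫⁻ y, ENNReal.ofReal (Real.exp (s * y)) ∂κ ≤
      ENNReal.ofReal (Real.exp (s ^ 2 * ρ ^ 2 / 2))) {u : ℝ} (hu : 0 ≤ u) (s : ℝ) :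
    ∫⁻ y, ENNReal.ofReal
        (Real.exp ((2 * y * s + y ^ 2 * u - s ^ 2) / (1 + u) / (2 * ρ ^ 2))) ∂κ ≤
      ENNReal.ofReal (Real.sqrt (1 + u)) := by
  -- The mixing density degenerates at `u = 0`, where the claim is the sub-Gaussian bound at the
  -- single parameter `s / ρ²`.
  rcases hu.eq_or_lt with rfl | hu
  · have h1 : ∀ y : ℝ, ENNReal.ofReal
        (Real.exp ((2 * y * s + y ^ 2 * 0 - s ^ 2) / (1 + 0) / (2 * ρ ^ 2))) =
        ENNReal.ofReal (Real.exp (-(s ^ 2 / (2 * ρ ^ 2)))) *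
          ENNReal.ofReal (Real.exp (s / ρ ^ 2 * y)) := by
      intro y
      rw [← ENNReal.ofReal_mul (by positivity), ← Real.exp_add]
      congr 2
      field_simp
      ring
    simp_rw [h1]
    rw [lintegral_const_mul _ (by fun_prop)]
    refine (mul_le_mul_right (h _) _).trans ?_
    rw [← ENNReal.ofReal_mul (by positivity), ← Real.exp_add]
    refine ENNReal.ofReal_le_ofReal ?_
    have : -(s ^ 2 / (2 * ρ ^ 2)) + (s / ρ ^ 2) ^ 2 * ρ ^ 2 / 2 = 0 := by field_simp; ring
    simp [this]
  -- `a` and `c` are chosen so that integrating out `g` reproduces the given exponential in `y`, up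
  -- to the factor `√(π/a)`. After Tonelli, `y` enters only through `exp (g y)`.
  · set a : ℝ := ρ ^ 2 * (1 + u) / (2 * u) with ha_def
    have ha : 0 < a := by positivity
    have hK : 0 < Real.sqrt (Real.pi / a) := Real.sqrt_pos.2 (by positivity)
    set c : ℝ := -(s ^ 2 / (2 * u * ρ ^ 2)) with hc_def
    have h1 : ∀ y : ℝ, ENNReal.ofReal (Real.sqrt (Real.pi / a)) * ENNReal.ofReal
        (Real.exp ((2 * y * s + y ^ 2 * u - s ^ 2) / (1 + u) / (2 * ρ ^ 2))) =
        ∫⁻ g : ℝ, ENNReal.ofReal (Real.exp (-a * g ^ 2 + (y + s / u) * g + c)) := by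
      intro y
      rw [lintegral_exp_quadratic ha, ← ENNReal.ofReal_mul hK.le]
      congr 3
      rw [ha_def, hc_def]
      field_simp
      ring
    have h2 : ∀ g y : ℝ, ENNReal.ofReal (Real.exp (-a * g ^ 2 + (y + s / u) * g + c)) =
        ENNReal.ofReal (Real.exp (-a * g ^ 2 + s / u * g + c)) *
          ENNReal.ofReal (Real.exp (g * y)) := by
      intro g y
      rw [← ENNReal.ofReal_mul (by positivity), ← Real.exp_add]
      congr 2
      ring
    have h3 : ENNReal.ofReal (Real.sqrt (Real.pi / a)) * ∫⁻ y, ENNReal.ofReal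
        (Real.exp ((2 * y * s + y ^ 2 * u - s ^ 2) / (1 + u) / (2 * ρ ^ 2))) ∂κ ≤
        ENNReal.ofReal (Real.sqrt (Real.pi / a)) * ENNReal.ofReal (Real.sqrt (1 + u)) := by
      rw [← lintegral_const_mul _ (by fun_prop)]
      simp_rw [h1]
      rw [lintegral_lintegral_swap (by fun_prop)]
      simp_rw [h2]
      calc ∫⁻ g : ℝ, ∫⁻ y, ENNReal.ofReal (Real.exp (-a * g ^ 2 + s / u * g + c)) *
            ENNReal.ofReal (Real.exp (g * y)) ∂κ
          ≤ ∫⁻ g : ℝ, ENNReal.ofReal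
              (Real.exp (-(ρ ^ 2 / (2 * u)) * g ^ 2 + s / u * g + c)) := by
            refine lintegral_mono fun g => ?_
            dsimp only
            rw [lintegral_const_mul _ (by fun_prop)]
            refine (mul_le_mul_right (h g) _).trans (le_of_eq ?_)
            rw [← ENNReal.ofReal_mul (by positivity), ← Real.exp_add]
            congr 2
            rw [ha_def]
            field_simp
            ring
        _ = _ := by
            rw [lintegral_exp_quadratic (by positivity), ← ENNReal.ofReal_mul hK.le,
              ← Real.sqrt_mul (by positivity)]
            -- The sub-Gaussian bound replaces `a` by `a - ρ²/2 = ρ²/(2u)`; completing the square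
            -- then cancels `c` exactly, and only the ratio of the normalizations, `√(1 + u)`,
            -- survives.
            have e1 : (s / u) ^ 2 / (4 * (ρ ^ 2 / (2 * u))) + c = 0 := by
              rw [hc_def]; field_simp; ring
            have e2 : Real.pi / (ρ ^ 2 / (2 * u)) = Real.pi / a * (1 + u) := by
              rw [ha_def]; field_simp
            rw [e1, e2, Real.exp_zero, mul_one]
    exact (ENNReal.mul_le_mul_iff_right (by simpa using hK) ENNReal.ofReal_ne_top).1 h3

/-- A bound on integrals against all sub-Gaussian laws carries over to a conditionally sub-Gaussian
variable, with a parameter that is measurable with respect to the conditioning. -/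
lemma lintegral_le_of_condSubgaussian {Ω β : Type*} [MeasurableSpace Ω] [mβ : MeasurableSpace β]
    {P : Measure Ω} [IsProbabilityMeasure P] {X : Ω → β} (hX : Measurable X) {e : Ω → ℝ}
    (he : Measurable e) {ρ : ℝ} (hint : ∀ s : ℝ, Integrable (fun ω => Real.exp (s * e ω)) P)
    (hmgf : ∀ s : ℝ, ∀ᵐ ω ∂P, (P[fun ω' => Real.exp (s * e ω') | mβ.comap X]) ω ≤
      Real.exp (s ^ 2 * ρ ^ 2 / 2))
    {f : β → ℝ → ENNReal} (hf : Measurable (Function.uncurry f)) {g : β → ENNReal}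
    (hfg : ∀ b, ∀ κ : Measure ℝ, IsProbabilityMeasure κ →
      (∀ s : ℝ, ∫⁻ y, ENNReal.ofReal (Real.exp (s * y)) ∂κ ≤
        ENNReal.ofReal (Real.exp (s ^ 2 * ρ ^ 2 / 2))) → ∫⁻ y, f b y ∂κ ≤ g b) :
    ∫⁻ ω, f (X ω) (e ω) ∂P ≤ ∫⁻ ω, g (X ω) ∂P := by
  -- The exceptional null set depends on the parameter; rational parameters allow a common one, and
  -- Fatou's lemma recovers the real ones below.
  have h1 : ∀ᵐ ω ∂P, ∀ q : ℚ,
      ∫⁻ y, ENNReal.ofReal (Real.exp (q * y)) ∂(ProbabilityTheory.condDistrib e X P (X ω)) ≤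
        ENNReal.ofReal (Real.exp ((q : ℝ) ^ 2 * ρ ^ 2 / 2)) := by
    rw [ae_all_iff]
    intro q
    have hexp : StronglyMeasurable fun y : ℝ => Real.exp ((q : ℝ) * y) :=
      (by fun_prop : Continuous _).stronglyMeasurable
    have hc := ProbabilityTheory.condExp_ae_eq_integral_condDistrib hX he.aemeasurable hexp (hint q)
    have hi := Integrable.condDistrib_ae (f := fun p : β × ℝ => Real.exp (q * p.2))
      hX.aemeasurable he.aemeasurable (by
        refine (integrable_map_measure ?_ (hX.prodMk he).aemeasurable).2 (hint q)
        exact (hexp.comp_measurable measurable_snd).aestronglyMeasurable)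
    filter_upwards [hc, hi, hmgf q] with ω h1 h2 h3
    rw [← ofReal_integral_eq_lintegral_ofReal h2
      (Filter.Eventually.of_forall fun _ => by positivity)]
    refine ENNReal.ofReal_le_ofReal ?_
    exact h1 ▸ h3
  have h2 : ∫⁻ ω, f (X ω) (e ω) ∂P =
      ∫⁻ ω, ∫⁻ y, f (X ω) y ∂(ProbabilityTheory.condDistrib e X P (X ω)) ∂P := by
    have h := ProbabilityTheory.compProd_map_condDistrib (mβ := mβ) (X := X) (μ := P)
      he.aemeasurable
    calc ∫⁻ ω, f (X ω) (e ω) ∂P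
        = ∫⁻ p, Function.uncurry f p ∂(P.map fun ω => (X ω, e ω)) := by
          rw [lintegral_map hf (hX.prodMk he)]; rfl
      _ = ∫⁻ b, ∫⁻ y, Function.uncurry f (b, y)
            ∂(ProbabilityTheory.condDistrib e X P b) ∂(P.map X) := by
          rw [← h, Measure.lintegral_compProd hf]
      _ = _ := by
          rw [lintegral_map hf.lintegral_kernel_prod_right' hX]; rfl
  rw [h2]
  refine lintegral_mono_ae ?_
  filter_upwards [h1] with ω hω
  refine hfg _ _ inferInstance fun s => ?_
  obtain ⟨q, hq⟩ : ∃ q : ℕ → ℚ, Filter.Tendsto (fun n => (q n : ℝ)) Filter.atTop (nhds s) := by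
    obtain ⟨u, hu, hlim⟩ := mem_closure_iff_seq_limit.1 (Rat.denseRange_cast (𝕜 := ℝ) s)
    choose q hq using hu
    exact ⟨q, by simpa [hq] using hlim⟩
  have hl : ∀ y : ℝ, ENNReal.ofReal (Real.exp (s * y)) =
      Filter.liminf (fun n => ENNReal.ofReal (Real.exp (q n * y))) Filter.atTop := by
    intro y
    refine (Filter.Tendsto.liminf_eq ?_).symm
    exact (ENNReal.continuous_ofReal.tendsto _).comp
      ((Real.continuous_exp.tendsto _).comp (hq.mul_const y))
  have hr : ENNReal.ofReal (Real.exp (s ^ 2 * ρ ^ 2 / 2)) = Filter.liminf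
      (fun n => ENNReal.ofReal (Real.exp ((q n : ℝ) ^ 2 * ρ ^ 2 / 2))) Filter.atTop := by
    refine (Filter.Tendsto.liminf_eq ?_).symm
    exact (ENNReal.continuous_ofReal.tendsto _).comp ((Real.continuous_exp.tendsto _).comp
      (((hq.pow 2).mul_const _).div_const _))
  simp_rw [hl]
  rw [hr]
  refine (lintegral_liminf_le fun n => by fun_prop).trans ?_
  exact Filter.liminf_le_liminf (Filter.Eventually.of_forall fun n => hω (q n))

/-- One step of the supermartingale of the self-normalized bound. -/
lemma lintegral_mul_exp_quadratic_le {Ω β : Type*} [MeasurableSpace Ω] [mβ : MeasurableSpace β]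
    {P : Measure Ω} [IsProbabilityMeasure P] {X : Ω → β} (hX : Measurable X) {e : Ω → ℝ}
    (he : Measurable e) {ρ : ℝ} (hρ : 0 < ρ)
    (hint : ∀ s : ℝ, Integrable (fun ω => Real.exp (s * e ω)) P)
    (hmgf : ∀ s : ℝ, ∀ᵐ ω ∂P, (P[fun ω' => Real.exp (s * e ω') | mβ.comap X]) ω ≤
      Real.exp (s ^ 2 * ρ ^ 2 / 2))
    {W : β → ENNReal} (hW : Measurable W) {u s : β → ℝ} (hu : Measurable u)
    (hs : Measurable s) (hu0 : ∀ b, 0 ≤ u b) :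
    ∫⁻ ω, W (X ω) * ENNReal.ofReal ((Real.sqrt (1 + u (X ω)))⁻¹ * Real.exp
        ((2 * e ω * s (X ω) + e ω ^ 2 * u (X ω) - s (X ω) ^ 2) / (1 + u (X ω)) / (2 * ρ ^ 2))) ∂P ≤
      ∫⁻ ω, W (X ω) ∂P := by
  refine lintegral_le_of_condSubgaussian hX he hint hmgf
    (f := fun b y => W b * ENNReal.ofReal ((Real.sqrt (1 + u b))⁻¹ * Real.exp
        ((2 * y * s b + y ^ 2 * u b - s b ^ 2) / (1 + u b) / (2 * ρ ^ 2)))) ?_ ?_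
  · simp only [Function.uncurry_def]
    fun_prop
  · intro b κ hκ h
    have h1 := hu0 b
    have hsq : 0 < Real.sqrt (1 + u b) := Real.sqrt_pos.2 (by linarith)
    rw [lintegral_const_mul _ (by fun_prop)]
    simp_rw [ENNReal.ofReal_mul (inv_nonneg.2 hsq.le)]
    rw [lintegral_const_mul _ (by fun_prop)]
    calc _ ≤ W b * (ENNReal.ofReal (Real.sqrt (1 + u b))⁻¹ *
          ENNReal.ofReal (Real.sqrt (1 + u b))) := by
          gcongr
          exact lintegral_exp_quadratic_le_of_subgaussian hρ h h1 (s b)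
      _ = W b := by
          rw [← ENNReal.ofReal_mul (inv_nonneg.2 hsq.le), inv_mul_cancel₀ hsq.ne']
          simp

/-- The same step for a conditioning σ-algebra. -/
lemma lintegral_mul_exp_quadratic_le_of_le {Ω : Type*} {m m0 : MeasurableSpace Ω} (hm : m ≤ m0)
    {P : Measure Ω} [IsProbabilityMeasure P] {e : Ω → ℝ} (he : Measurable e) {ρ : ℝ} (hρ : 0 < ρ)
    (hint : ∀ s : ℝ, Integrable (fun ω => Real.exp (s * e ω)) P)
    (hmgf : ∀ s : ℝ, ∀ᵐ ω ∂P, (P[fun ω' => Real.exp (s * e ω') | m]) ω ≤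
      Real.exp (s ^ 2 * ρ ^ 2 / 2))
    {W : Ω → ENNReal} (hW : Measurable[m] W) {u s : Ω → ℝ} (hu : Measurable[m] u)
    (hs : Measurable[m] s) (hu0 : ∀ ω, 0 ≤ u ω) :
    ∫⁻ ω, W ω * ENNReal.ofReal ((Real.sqrt (1 + u ω))⁻¹ * Real.exp
        ((2 * e ω * s ω + e ω ^ 2 * u ω - s ω ^ 2) / (1 + u ω) / (2 * ρ ^ 2))) ∂P ≤
      ∫⁻ ω, W ω ∂P := by
  have hcomap : m.comap (id : Ω → Ω) = m := MeasurableSpace.comap_id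
  -- Conditioning on `m` is conditioning on the identity map from `Ω` to `Ω` equipped with `m`.
  exact @lintegral_mul_exp_quadratic_le Ω Ω m0 m P _ id (measurable_id'' hm) e he ρ hρ hint
    (hcomap.symm ▸ hmgf) W hW u s hu hs hu0

/-! ### The maximal inequality. -/

/-- A maximal inequality for nonnegative supermartingales over a finite horizon. -/
lemma mul_measure_exists_le_of_setLIntegral_le {Ω : Type*} [MeasurableSpace Ω] {P : Measure Ω}
    [IsProbabilityMeasure P] {F : ℕ → MeasurableSpace Ω} {T : ℕ}
    (hF : ∀ t ∈ Finset.Icc 1 T, F t ≤ ‹MeasurableSpace Ω›)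
    (hmono : ∀ s t, s ≤ t → F s ≤ F t) {M : ℕ → Ω → ENNReal}
    (hM : ∀ t ∈ Finset.Icc 1 T, Measurable[F t] (M t)) (hM1 : ∀ ω, M 1 ω ≤ 1)
    (hstep : ∀ t ∈ Finset.Ico 1 T, ∀ B : Set Ω, MeasurableSet[F t] B →
      ∫⁻ ω in B, M (t + 1) ω ∂P ≤ ∫⁻ ω in B, M t ω ∂P) (c : ENNReal) :
    c * P {ω | ∃ t ∈ Finset.Icc 1 T, c ≤ M t ω} ≤ 1 := by
  have hmeas : ∀ t ≤ T, ∀ r, t ≤ r → MeasurableSet[F r] {ω | ∃ k ∈ Finset.Icc 1 t, c ≤ M k ω} := by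
    intro t ht r hr
    have : {ω | ∃ k ∈ Finset.Icc 1 t, c ≤ M k ω} =
        ⋃ k ∈ Finset.Icc 1 t, {ω | c ≤ M k ω} := by ext; simp
    rw [this]
    refine Finset.measurableSet_biUnion _ fun k hk => ?_
    simp only [Finset.mem_Icc] at hk
    exact hmono k r (by omega) _ (hM k (by simp; omega) measurableSet_Ici)
  -- The left side is the threshold mass already crossed plus the process not yet stopped. It does
  -- not increase with `t`: the uncrossed event lies in `F t`, so `hstep` applies to it, and on the
  -- newly crossed part `M (t + 1) ≥ c`.
  have key : ∀ t, 1 ≤ t → t ≤ T → c * P {ω | ∃ k ∈ Finset.Icc 1 t, c ≤ M k ω} +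
      ∫⁻ ω in {ω | ∃ k ∈ Finset.Icc 1 t, c ≤ M k ω}ᶜ, M t ω ∂P ≤ 1 := by
    intro t ht
    induction t, ht using Nat.le_induction with
    | base =>
      intro hT
      have hB := hF 1 (by simp; omega) _ (hmeas 1 hT 1 le_rfl)
      calc _ ≤ ∫⁻ ω in {ω | ∃ k ∈ Finset.Icc 1 1, c ≤ M k ω}, M 1 ω ∂P +
            ∫⁻ ω in {ω | ∃ k ∈ Finset.Icc 1 1, c ≤ M k ω}ᶜ, M 1 ω ∂P := by
            gcongr
            rw [← setLIntegral_const]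
            exact setLIntegral_mono' hB fun ω hω => by simpa using hω
        _ = ∫⁻ ω, M 1 ω ∂P := lintegral_add_compl _ hB
        _ ≤ ∫⁻ _, 1 ∂P := lintegral_mono hM1
        _ = 1 := by simp
    | succ t ht ih =>
      intro hT
      set A := {ω | ∃ k ∈ Finset.Icc 1 t, c ≤ M k ω} with hA_def
      set A' := {ω | ∃ k ∈ Finset.Icc 1 (t + 1), c ≤ M k ω} with hA'_def
      have hA : MeasurableSet A := hF (t + 1) (by simp; omega) _ (hmeas t (by omega) _ (by omega))
      have hA' : MeasurableSet A' := hF (t + 1) (by simp; omega) _ (hmeas (t + 1) hT _ le_rfl)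
      have hAA' : A ⊆ A' := by
        rintro ω ⟨k, hk, h⟩
        exact ⟨k, by simp at hk ⊢; omega, h⟩
      have hdiff : ∀ ω ∈ A' \ A, c ≤ M (t + 1) ω := by
        rintro ω ⟨⟨k, hk, h⟩, hn⟩
        by_cases hk' : k ≤ t
        · exact absurd ⟨k, by simp at hk ⊢; omega, h⟩ hn
        · have : k = t + 1 := by simp at hk; omega
          exact this ▸ h
      have hsplit : Aᶜ = (A' \ A) ∪ A'ᶜ := by
        ext ω
        have := @hAA' ω
        simp only [Set.mem_compl_iff, Set.mem_union, Set.mem_sdiff]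
        tauto
      calc c * P A' + ∫⁻ ω in A'ᶜ, M (t + 1) ω ∂P
          = c * P A + (c * P (A' \ A) + ∫⁻ ω in A'ᶜ, M (t + 1) ω ∂P) := by
            rw [← add_assoc, ← mul_add, ← measure_union Set.disjoint_sdiff_right (hA'.diff hA),
              Set.union_sdiff_cancel hAA']
        _ ≤ c * P A + (∫⁻ ω in A' \ A, M (t + 1) ω ∂P + ∫⁻ ω in A'ᶜ, M (t + 1) ω ∂P) := by
            gcongr
            rw [← setLIntegral_const]
            exact setLIntegral_mono' (hA'.diff hA) hdiff
        _ = c * P A + ∫⁻ ω in Aᶜ, M (t + 1) ω ∂P := by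
            rw [hsplit, lintegral_union hA'.compl
              (disjoint_compl_right.mono_left Set.sdiff_subset)]
        _ ≤ c * P A + ∫⁻ ω in Aᶜ, M t ω ∂P := by
            exact add_le_add_right
              (hstep t (by simp; omega) _ (hmeas t (by omega) t le_rfl).compl) _
        _ ≤ 1 := ih (by omega)
  rcases Nat.eq_zero_or_pos T with rfl | hT
  · simp
  · exact le_self_add.trans (key T hT le_rfl)

/-! ### Measurability of the Gram matrix, the noise sum and the history. -/

lemma Matrix.measurable_det_of_entries {Ω ι : Type*} [MeasurableSpace Ω] [Fintype ι]
    [DecidableEq ι] {V : Ω → Matrix ι ι ℝ} (hV : ∀ i j, Measurable fun ω => V ω i j) :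
    Measurable fun ω => (V ω).det := by
  simp_rw [Matrix.det_apply]
  refine Finset.measurable_sum _ fun σ _ => Measurable.const_smul ?_ _
  exact Finset.measurable_prod _ fun i _ => hV _ _

lemma Matrix.measurable_inv_of_entries {Ω ι : Type*} [MeasurableSpace Ω] [Fintype ι]
    [DecidableEq ι] {V : Ω → Matrix ι ι ℝ} (hV : ∀ i j, Measurable fun ω => V ω i j) (i j : ι) :
    Measurable fun ω => (V ω)⁻¹ i j := by
  simp only [Matrix.inv_def, Ring.inverse_eq_inv', Matrix.smul_apply, smul_eq_mul,
    Matrix.adjugate_apply]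
  refine (measurable_det_of_entries hV).inv.mul (measurable_det_of_entries fun k l => ?_)
  simp only [Matrix.updateRow_apply]
  split_ifs
  · exact measurable_const
  · exact hV k l

lemma Matrix.measurable_dotProduct_inv_mulVec {Ω ι : Type*} [MeasurableSpace Ω] [Fintype ι]
    [DecidableEq ι] {V : Ω → Matrix ι ι ℝ} (hV : ∀ i j, Measurable fun ω => V ω i j)
    {a b : Ω → ι → ℝ} (ha : ∀ i, Measurable fun ω => a ω i)
    (hb : ∀ i, Measurable fun ω => b ω i) :
    Measurable fun ω => a ω ⬝ᵥ (V ω)⁻¹ *ᵥ b ω := by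
  simp only [dotProduct, Matrix.mulVec]
  refine Finset.measurable_sum _ fun i _ => (ha i).mul (Finset.measurable_sum _ fun j _ => ?_)
  exact (measurable_inv_of_entries hV i j).mul (hb j)

/-- The noise `∑_{k=1}^{t-1} e_k x_k` that enters the least-squares estimator. -/
noncomputable def noiseSum {d : ℕ} (x : ℕ → Vec d) (e : ℕ → ℝ) (t : ℕ) : Vec d :=
  ∑ k ∈ Finset.Ico 1 t, e k • x k

section Measurability

variable {Ω : Type*} [MeasurableSpace Ω] {d n : ℕ} (I : LearnerInput d n) {x : ℕ → Ω → Vec d}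
  {e : ℕ → Ω → ℝ} {t : ℕ}

lemma LearnerInput.measurable_gram_apply (hx : ∀ k ∈ Finset.Ico 1 t, Measurable (x k))
    (i j : Fin d) : Measurable fun ω => I.gram (fun k => x k ω) t i j := by
  simp only [LearnerInput.gram, Matrix.add_apply, Matrix.sum_apply, Matrix.vecMulVec_apply]
  refine (Finset.measurable_sum _ fun k hk => ?_).add measurable_const
  have := hx k hk
  fun_prop

lemma measurable_noiseSum_apply (hx : ∀ k ∈ Finset.Ico 1 t, Measurable (x k))
    (he : ∀ k ∈ Finset.Ico 1 t, Measurable (e k)) (i : Fin d) :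
    Measurable fun ω => noiseSum (fun k => x k ω) (fun k => e k ω) t i := by
  have : Measurable fun ω => noiseSum (fun k => x k ω) (fun k => e k ω) t := by
    simp only [noiseSum]
    refine Finset.measurable_sum _ fun k hk => ?_
    exact (he k hk).smul (hx k hk)
  fun_prop

end Measurability

lemma noiseSum_succ {d : ℕ} (x : ℕ → Vec d) (e : ℕ → ℝ) {t : ℕ} (ht : 1 ≤ t) :
    noiseSum x e (t + 1) = noiseSum x e t + e t • x t := by
  rw [noiseSum, Finset.sum_Ico_succ_top ht, noiseSum]

section History

variable {Ω : Type*} {d : ℕ} (x : ℕ → Ω → Vec d) (e : ℕ → Ω → ℝ)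

lemma history_mono {s t : ℕ} (h : s ≤ t) : history x e s ≤ history x e t := by
  refine sup_le_sup (biSup_mono fun k hk => ?_) (biSup_mono fun k hk => ?_)
  · simp at hk ⊢; omega
  · simp at hk ⊢; omega

lemma measurable_action_history {k t : ℕ} (hk : k ∈ Finset.Icc 1 t) :
    Measurable[history x e t] (x k) :=
  measurable_iff_comap_le.2 (le_sup_of_le_left
    (le_iSup₂ (f := fun k (_ : k ∈ Finset.Icc 1 t) =>
      MeasurableSpace.comap (x k) (inferInstance : MeasurableSpace (Vec d))) k hk))

lemma measurable_noise_history {k t : ℕ} (hk : k ∈ Finset.Ico 1 t) :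
    Measurable[history x e t] (e k) :=
  measurable_iff_comap_le.2 (le_sup_of_le_right
    (le_iSup₂ (f := fun k (_ : k ∈ Finset.Ico 1 t) =>
      MeasurableSpace.comap (e k) (inferInstance : MeasurableSpace ℝ)) k hk))

lemma history_le [m0 : MeasurableSpace Ω] {T t : ℕ} (hx : ∀ k ∈ Finset.Icc 1 T, Measurable (x k))
    (he : ∀ k ∈ Finset.Icc 1 T, Measurable (e k)) (ht : t ≤ T) : history x e t ≤ m0 := by
  refine sup_le (iSup₂_le fun k hk => ?_) (iSup₂_le fun k hk => ?_)
  · exact (hx k (by simp at hk ⊢; omega)).comap_le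
  · exact (he k (by simp at hk ⊢; omega)).comap_le

end History

/-! ### The self-normalized bound. -/

namespace CondSubgaussianNoise

variable {Ω : Type*} [MeasurableSpace Ω] {d n T : ℕ} {P : Measure Ω} [IsProbabilityMeasure P]
  {x : ℕ → Ω → Vec d} {e : ℕ → Ω → ℝ}

/-- For `ρ = 0` the moment bounds at `±1` give `E[cosh e_t] ≤ 1`, while `cosh > 1` away from zero.
This covers the case in which the supermartingale would divide by `ρ²`. -/
lemma ae_eq_zero (hx : ∀ t ∈ Finset.Icc 1 T, Measurable (x t))
    (h : CondSubgaussianNoise P x e 0 T) {t : ℕ} (ht : t ∈ Finset.Icc 1 T) :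
    ∀ᵐ ω ∂P, e t ω = 0 := by
  have hm := history_le x e hx h.measurable (Finset.mem_Icc.1 ht).2
  have hint : ∀ s : ℝ, ∫ ω, Real.exp (s * e t ω) ∂P ≤ 1 := by
    intro s
    rw [← integral_condExp hm]
    calc _ ≤ ∫ _, (1 : ℝ) ∂P := by
          refine integral_mono_ae integrable_condExp (integrable_const _) ?_
          filter_upwards [h.condMGF t ht s] with ω hω
          simpa using hω
      _ = 1 := by simp
  have h1 := h.integrable_exp t ht 1
  have h2 := h.integrable_exp t ht (-1)
  have h3 : ∀ y : ℝ, 0 ≤ Real.exp (1 * y) + Real.exp (-1 * y) - 2 := by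
    intro y
    have := Real.one_le_cosh y
    rw [Real.cosh_eq] at this
    simp only [one_mul, neg_mul]
    linarith
  have h4 : ∫ ω, (Real.exp (1 * e t ω) + Real.exp (-1 * e t ω) - 2) ∂P = 0 := by
    refine le_antisymm ?_ (integral_nonneg fun ω => h3 _)
    rw [integral_sub (f := fun ω => Real.exp (1 * e t ω) + Real.exp (-1 * e t ω))
      (h1.add h2) (integrable_const _), integral_add h1 h2]
    have := hint 1
    have := hint (-1)
    simp only [integral_const, probReal_univ, one_smul]
    linarith
  rw [integral_eq_zero_iff_of_nonneg (fun ω => h3 _)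
    ((h1.add h2).sub (integrable_const _))] at h4
  filter_upwards [h4] with ω hω
  have : Real.cosh (e t ω) = 1 := by
    rw [Real.cosh_eq]
    simp only [one_mul, neg_mul, Pi.zero_apply] at hω
    linarith
  by_contra hne
  exact (Real.one_lt_cosh.2 hne).ne' this

/-- The self-normalized bound, uniformly over a finite horizon. -/
lemma measure_noiseSum_gt_le (I : LearnerInput d n) (hlam : 0 < I.lam) (hρ : 0 ≤ I.rho)
    (hx : ∀ t ∈ Finset.Icc 1 T, Measurable (x t))
    (h : CondSubgaussianNoise P x e I.rho T) {δ : ℝ} (hδ : 0 < δ) :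
    P {ω | ∃ t ∈ Finset.Icc 1 T,
      I.rho * Real.sqrt (Real.log ((I.gram (fun k => x k ω) t).det / I.lam ^ d)
          + 2 * Real.log (1 / δ)) <
        weightedNorm (I.gram (fun k => x k ω) t)⁻¹
          (noiseSum (fun k => x k ω) (fun k => e k ω) t)} ≤ ENNReal.ofReal δ := by
  rcases hρ.eq_or_lt with hρ0 | hρ
  · rw [← hρ0] at h ⊢
    have hz : ∀ᵐ ω ∂P, ∀ t ∈ Finset.Icc 1 T, e t ω = 0 :=
      (ae_ball_iff (Finset.countable_toSet _)).2 fun t ht => h.ae_eq_zero hx ht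
    have : P {ω | ∃ t ∈ Finset.Icc 1 T,
      0 * Real.sqrt (Real.log ((I.gram (fun k => x k ω) t).det / I.lam ^ d)
          + 2 * Real.log (1 / δ)) <
        weightedNorm (I.gram (fun k => x k ω) t)⁻¹
          (noiseSum (fun k => x k ω) (fun k => e k ω) t)} = 0 := by
      rw [measure_eq_zero_iff_ae_notMem]
      filter_upwards [hz] with ω hω
      rintro ⟨t, ht, hlt⟩
      have h0 : noiseSum (fun k => x k ω) (fun k => e k ω) t = 0 := by
        refine Finset.sum_eq_zero fun k hk => ?_
        simp only [hω k (by simp at hk ht ⊢; omega), zero_smul]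
      rw [h0] at hlt
      simp [weightedNorm] at hlt
    rw [this]
    exact zero_le
  have hpd : ∀ ω t, (I.gram (fun k => x k ω) t).PosDef := fun ω t => I.posDef_gram hlam _ t
  have hL : 0 < I.lam ^ d := pow_pos hlam d
  let b : ℕ → Ω → Fin d → ℝ := fun t ω => (noiseSum (fun k => x k ω) (fun k => e k ω) t).ofLp
  let V : ℕ → Ω → Matrix (Fin d) (Fin d) ℝ := fun t ω => I.gram (fun k => x k ω) t
  -- `M t` involves actions and noise only up to round `t - 1`, hence is measurable for the history
  -- at `t`, as is the next action `x t`.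
  let M : ℕ → Ω → ENNReal := fun t ω => ENNReal.ofReal
    ((Real.sqrt ((V t ω).det / I.lam ^ d))⁻¹ *
      Real.exp (b t ω ⬝ᵥ (V t ω)⁻¹ *ᵥ b t ω / (2 * I.rho ^ 2)))
  have hVm : ∀ t i j, Measurable[history x e t] fun ω => V t ω i j := fun t i j =>
    @LearnerInput.measurable_gram_apply Ω (history x e t) d n I x t
      (fun k hk => measurable_action_history x e (by simp at hk ⊢; omega)) i j
  have hbm : ∀ t i, Measurable[history x e t] fun ω => b t ω i := fun t i =>
    @measurable_noiseSum_apply Ω (history x e t) d x e t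
      (fun k hk => measurable_action_history x e (by simp at hk ⊢; omega))
      (fun k hk => measurable_noise_history x e hk) i
  have hxm : ∀ t, 1 ≤ t → ∀ i, Measurable[history x e t] fun ω => (x t ω).ofLp i := by
    intro t ht i
    have := measurable_action_history x e (k := t) (t := t) (by simp; omega)
    exact (by fun_prop : Measurable fun v : Vec d => v.ofLp i).comp this
  have hMm : ∀ t, Measurable[history x e t] (M t) := by
    intro t
    refine ENNReal.measurable_ofReal.comp (Measurable.mul ?_ ?_)
    · exact ((@Matrix.measurable_det_of_entries Ω _ (history x e t) _ _ _ (hVm t)).div_const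
        _).sqrt.inv
    · exact ((@Matrix.measurable_dotProduct_inv_mulVec Ω _ (history x e t) _ _ _ (hVm t) _ _
        (hbm t) (hbm t)).div_const _).exp
  have hstep : ∀ t ∈ Finset.Ico 1 T, ∀ B : Set Ω, MeasurableSet[history x e t] B →
      ∫⁻ ω in B, M (t + 1) ω ∂P ≤ ∫⁻ ω in B, M t ω ∂P := by
    intro t ht B hB
    have ht1 : 1 ≤ t := (Finset.mem_Ico.1 ht).1
    have htT : t ∈ Finset.Icc 1 T := by simp at ht ⊢; omega
    have hm := history_le x e hx h.measurable (Finset.mem_Icc.1 htT).2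
    have hu0 : ∀ ω, 0 ≤ (x t ω).ofLp ⬝ᵥ (V t ω)⁻¹ *ᵥ (x t ω).ofLp :=
      fun ω => (hpd ω t).dotProduct_inv_mulVec_nonneg _
    -- The indicator of `B` is absorbed into the weight, turning the inequality for full integrals
    -- into one over `B`.
    have key := lintegral_mul_exp_quadratic_le_of_le hm (h.measurable t htT) hρ
      (h.integrable_exp t htT) (h.condMGF t htT) (W := B.indicator (M t))
      (u := fun ω => (x t ω).ofLp ⬝ᵥ (V t ω)⁻¹ *ᵥ (x t ω).ofLp)
      (s := fun ω => (x t ω).ofLp ⬝ᵥ (V t ω)⁻¹ *ᵥ b t ω)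
      ((hMm t).indicator hB)
      (@Matrix.measurable_dotProduct_inv_mulVec Ω _ (history x e t) _ _ _ (hVm t) _ _
        (hxm t ht1) (hxm t ht1))
      (@Matrix.measurable_dotProduct_inv_mulVec Ω _ (history x e t) _ _ _ (hVm t) _ _
        (hxm t ht1) (hbm t)) hu0
    rw [lintegral_indicator (hm _ hB)] at key
    refine le_trans (le_of_eq ?_) key
    rw [← lintegral_indicator (hm _ hB)]
    refine lintegral_congr fun ω => ?_
    by_cases hω : ω ∈ B
    · simp only [Set.indicator_of_mem hω, M]
      have hdet := (hpd ω t).det_pos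
      have hu := hu0 ω
      rw [← ENNReal.ofReal_mul (by positivity)]
      congr 1
      have e1 : V (t + 1) ω = V t ω + Matrix.vecMulVec (x t ω).ofLp (x t ω).ofLp :=
        I.gram_succ _ ht1
      have e2 : b (t + 1) ω = b t ω + e t ω • (x t ω).ofLp := by
        simp only [b, noiseSum_succ _ _ ht1]
        rfl
      rw [e1, e2, (hpd ω t).det_add_vecMulVec, (hpd ω t).dotProduct_inv_add_vecMulVec,
        mul_div_right_comm, Real.sqrt_mul (by positivity), add_div, Real.exp_add, mul_inv]
      ring
    · simp [Set.indicator_of_notMem hω]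
  have hM1 : ∀ ω, M 1 ω ≤ 1 := by
    intro ω
    simp [M, b, V, noiseSum, I.det_gram_one, hL.ne']
  have hmax := mul_measure_exists_le_of_setLIntegral_le (F := history x e) (T := T)
    (fun t ht => history_le x e hx h.measurable (Finset.mem_Icc.1 ht).2)
    (fun s t => history_mono x e) (fun t _ => hMm t) hM1 hstep (ENNReal.ofReal (1 / δ))
  have hsub : {ω | ∃ t ∈ Finset.Icc 1 T,
      I.rho * Real.sqrt (Real.log ((I.gram (fun k => x k ω) t).det / I.lam ^ d)
          + 2 * Real.log (1 / δ)) <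
        weightedNorm (I.gram (fun k => x k ω) t)⁻¹
          (noiseSum (fun k => x k ω) (fun k => e k ω) t)} ⊆
      {ω | ∃ t ∈ Finset.Icc 1 T, ENNReal.ofReal (1 / δ) ≤ M t ω} := by
    rintro ω ⟨t, ht, hlt⟩
    refine ⟨t, ht, ENNReal.ofReal_le_ofReal ?_⟩
    have hdet := (hpd ω t).det_pos
    change _ < Real.sqrt (b t ω ⬝ᵥ (V t ω)⁻¹ *ᵥ b t ω) at hlt
    set D := (V t ω).det / I.lam ^ d with hD
    have hD0 : 0 < D := div_pos hdet hL
    set Q := b t ω ⬝ᵥ (V t ω)⁻¹ *ᵥ b t ω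
    -- Comparing square roots avoids any sign condition on the radicand, which may be negative since
    -- `δ ≤ 1` is not assumed here.
    have hlt' : Real.sqrt (Real.log D + 2 * Real.log (1 / δ)) < Real.sqrt (Q / I.rho ^ 2) := by
      rw [Real.sqrt_div' _ (sq_nonneg _), Real.sqrt_sq hρ.le, lt_div_iff₀ hρ, mul_comm]
      exact hlt
    have hlt2 := lt_of_not_ge fun hle => (Real.sqrt_le_sqrt hle).not_gt hlt'
    rw [le_inv_mul_iff₀ (Real.sqrt_pos.2 hD0)]
    calc Real.sqrt D * (1 / δ) = Real.exp (Real.log D / 2 + Real.log (1 / δ)) := by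
          rw [Real.exp_add, Real.exp_log (by positivity), ← Real.log_sqrt hD0.le,
            Real.exp_log (Real.sqrt_pos.2 hD0)]
      _ ≤ Real.exp (Q / (2 * I.rho ^ 2)) := by
          refine Real.exp_le_exp.2 ?_
          have : Q / (2 * I.rho ^ 2) = Q / I.rho ^ 2 / 2 := by field_simp
          rw [this]
          linarith
  refine (measure_mono hsub).trans ?_
  have hc : ENNReal.ofReal δ * ENNReal.ofReal (1 / δ) = 1 := by
    rw [← ENNReal.ofReal_mul hδ.le, mul_one_div_cancel hδ.ne', ENNReal.ofReal_one]
  calc _ = ENNReal.ofReal δ * (ENNReal.ofReal (1 / δ) *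
        P {ω | ∃ t ∈ Finset.Icc 1 T, ENNReal.ofReal (1 / δ) ≤ M t ω}) := by
        rw [← mul_assoc, hc, one_mul]
    _ ≤ ENNReal.ofReal δ * 1 := by gcongr
    _ = _ := mul_one _

end CondSubgaussianNoise

/-! ### Boxes and convex sets. -/

lemma mem_box_iff {m : ℕ} {c w : Vec m} {s : ℝ} (hs : 0 ≤ s) :
    w ∈ box c s ↔ ∀ i, |w i - c i| ≤ s := by
  constructor
  · rintro ⟨v, hv, rfl⟩ i
    simp only [PiLp.add_apply, PiLp.smul_apply, smul_eq_mul, add_sub_cancel_left, abs_mul,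
      abs_of_nonneg hs]
    exact mul_le_of_le_one_right hs (hv i)
  · intro h
    rcases hs.eq_or_lt with rfl | hs
    · refine ⟨0, fun i => by simp, ?_⟩
      ext i
      have := abs_nonpos_iff.1 (h i)
      simp
      linarith
    · refine ⟨s⁻¹ • (w - c), fun i => ?_, ?_⟩
      · simp only [PiLp.smul_apply, PiLp.sub_apply, smul_eq_mul, abs_mul, abs_inv, abs_of_pos hs]
        rw [inv_mul_le_iff₀ hs, mul_one]
        exact h i
      · rw [smul_inv_smul₀ hs.ne', add_sub_cancel]

lemma norm_le_sqrt_mul_of_forall_abs_le {m : ℕ} {v : Vec m} {c : ℝ} (hc : 0 ≤ c)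
    (h : ∀ i, |v i| ≤ c) : ‖v‖ ≤ Real.sqrt m * c := by
  rw [EuclideanSpace.norm_eq, ← Real.sqrt_sq hc, ← Real.sqrt_mul (Nat.cast_nonneg m)]
  refine Real.sqrt_le_sqrt ?_
  calc ∑ i, ‖v i‖ ^ 2 ≤ ∑ _i : Fin m, c ^ 2 :=
        Finset.sum_le_sum fun i _ => pow_le_pow_left₀ (norm_nonneg _) (h i) 2
    _ = m * c ^ 2 := by simp

lemma matVec_smul {m d : ℕ} (M : Matrix (Fin m) (Fin d) ℝ) (c : ℝ) (v : Vec d) :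
    matVec M (c • v) = c • matVec M v := by
  simp [matVec, Matrix.mulVec_smul]

lemma matVec_apply {m d : ℕ} (M : Matrix (Fin m) (Fin d) ℝ) (v : Vec d) (i : Fin m) :
    matVec M v i = inner ℝ (rowVec M i) v := by
  rw [inner_eq_dotProduct]
  rfl

/-- Shrinking a box that meets a convex set around a ball brings it into the set. -/
lemma box_smul_subset {m : ℕ} {G : Set (Vec m)} (hG : Convex ℝ G) {r : ℝ} (hr : 0 < r)
    (hrG : Metric.closedBall (0 : Vec m) r ⊆ G) {c : Vec m} {s : ℝ} (hs : 0 ≤ s)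
    (hne : (box c s ∩ G).Nonempty) {μ : ℝ} (hμ : μ = r / (r + 2 * Real.sqrt m * s)) :
    box (μ • c) (μ * s) ⊆ G := by
  obtain ⟨y, hy, hyG⟩ := hne
  rw [mem_box_iff hs] at hy
  have hden : 0 < r + 2 * Real.sqrt m * s := by positivity
  have hμ0 : 0 ≤ μ := by rw [hμ]; positivity
  -- This identity dictates the value of `μ`: a point of the shrunken box is within `2μs` of `μ • y`
  -- in each coordinate, hence within `(1 - μ) r` in norm. It is thus a convex combination of `y`
  -- and a point of the ball.
  have hμ1 : Real.sqrt m * (2 * (μ * s)) = (1 - μ) * r := by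
    rw [hμ]; field_simp; ring
  have hμ2 : μ ≤ 1 := by
    rw [hμ, div_le_one hden]
    have : 0 ≤ 2 * Real.sqrt m * s := by positivity
    linarith
  intro w hw
  rw [mem_box_iff (by positivity)] at hw
  have hdist : ‖w - μ • y‖ ≤ (1 - μ) * r := by
    rw [← hμ1]
    refine norm_le_sqrt_mul_of_forall_abs_le (by positivity) fun i => ?_
    have h1 := hw i
    have h2 : |μ * (c i - y i)| ≤ μ * s := by
      rw [abs_mul, abs_of_nonneg hμ0, abs_sub_comm]
      exact mul_le_mul_of_nonneg_left (hy i) hμ0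
    have h3 : (w - μ • y) i = (w i - (μ • c) i) + μ * (c i - y i) := by simp; ring
    rw [h3]
    exact (abs_add_le _ _).trans (by linarith)
  -- For `μ = 1` there is no room to divide by `1 - μ`, but then the distance is zero and the point
  -- is `y`.
  rcases hμ2.eq_or_lt with h | h
  · rw [h, sub_self, zero_mul, one_smul] at hdist
    rwa [sub_eq_zero.1 (norm_le_zero_iff.1 hdist)]
  · have h1 : 0 < 1 - μ := by linarith
    have hz : (1 - μ)⁻¹ • (w - μ • y) ∈ G := hrG (by
      rw [mem_closedBall_zero_iff, norm_smul, norm_inv, Real.norm_of_nonneg h1.le,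
        inv_mul_le_iff₀ h1]
      exact hdist)
    have := hG hyG hz hμ0 h1.le (by ring)
    rwa [smul_inv_smul₀ h1.ne', add_sub_cancel] at this

/-! ### Confidence sets and the regret of one round. -/

namespace LearnerInput

variable {d n : ℕ} (I : LearnerInput d n)

lemma beta_nonneg (hρ : 0 ≤ I.rho) (hSA : 0 < I.SA) (t : ℕ) : 0 ≤ I.beta t := by
  have : 0 ≤ I.S := hSA.le.trans (le_max_left _ _)
  unfold beta
  positivity

lemma beta_mono (hρ : 0 ≤ I.rho) (hlam : 0 < I.lam) (hδ0 : 0 < I.delta) {s t : ℕ}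
    (hs : 1 ≤ s) (hst : s ≤ t) : I.beta s ≤ I.beta t := by
  have hs' : (1 : ℝ) ≤ s := by exact_mod_cast hs
  have hst' : (s : ℝ) ≤ t := by exact_mod_cast hst
  have : 0 ≤ ((s : ℝ) - 1) / I.lam := div_nonneg (by linarith) hlam.le
  unfold beta
  gcongr

/-- The confidence ellipsoid, from a bound on the self-normalized noise. -/
lemma abs_inner_estimator_sub_le (hd : 2 ≤ d) (hlam : 0 < I.lam) (hρ : 0 ≤ I.rho)
    (hδ0 : 0 < I.delta) (hδ1 : I.delta < 1) {x : ℕ → Vec d} {y e : ℕ → ℝ} {t : ℕ} (ht : 1 ≤ t)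
    (hx : ∀ k ∈ Finset.Ico 1 t, ‖x k‖ ≤ 1) {a : Vec d} (ha : ‖a‖ ≤ I.S)
    (hy : ∀ k, y k = inner ℝ a (x k) + e k)
    (he : weightedNorm (I.gram x t)⁻¹ (noiseSum x e t) ≤
      I.rho * Real.sqrt (Real.log ((I.gram x t).det / I.lam ^ d)
        + 2 * Real.log (1 / (I.delta / ((n : ℝ) + 1))))) (v : Vec d) :
    |inner ℝ (I.estimator x y t) v - inner ℝ a v| ≤ I.width x t v := by
  have hpd := I.posDef_gram hlam x t
  have hd' : (2 : ℝ) ≤ d := by exact_mod_cast hd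
  have ht' : (1 : ℝ) ≤ t := by exact_mod_cast ht
  have hδ' : 0 < I.delta / ((n : ℝ) + 1) := by positivity
  -- Adding and subtracting `λ a` exhibits `V_t a`, so the estimation error is `V_t⁻¹` applied to
  -- the noise minus the regularization bias `λ a`.
  have hsum : (∑ k ∈ Finset.Ico 1 t, y k • x k).ofLp =
      I.gram x t *ᵥ a.ofLp + ((noiseSum x e t).ofLp - I.lam • a.ofLp) := by
    rw [gram, Matrix.add_mulVec, Matrix.smul_mulVec, Matrix.one_mulVec, Matrix.sum_mulVec]
    have : ∑ k ∈ Finset.Ico 1 t, y k • x k =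
        ∑ k ∈ Finset.Ico 1 t, inner ℝ a (x k) • x k + noiseSum x e t := by
      rw [noiseSum, ← Finset.sum_add_distrib]
      exact Finset.sum_congr rfl fun k _ => by rw [hy, add_smul]
    rw [this]
    have h2 : (∑ k ∈ Finset.Ico 1 t, inner ℝ a (x k) • x k).ofLp =
        ∑ k ∈ Finset.Ico 1 t, Matrix.vecMulVec (x k).ofLp (x k).ofLp *ᵥ a.ofLp := by
      rw [WithLp.ofLp_sum]
      refine Finset.sum_congr rfl fun k _ => ?_
      rw [Matrix.vecMulVec_mulVec, inner_eq_dotProduct, dotProduct_comm]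
      ext i
      simp [mul_comm]
    rw [WithLp.ofLp_add, h2]
    abel
  have hdiff : inner ℝ (I.estimator x y t) v - inner ℝ a v =
      (noiseSum x e t).ofLp ⬝ᵥ (I.gram x t)⁻¹ *ᵥ v.ofLp
        - I.lam * (a.ofLp ⬝ᵥ (I.gram x t)⁻¹ *ᵥ v.ofLp) := by
    rw [inner_eq_dotProduct, inner_eq_dotProduct, estimator, matVec, hsum]
    simp only [Matrix.mulVec_add, hpd.inv_mulVec_mulVec, Matrix.mulVec_sub, Matrix.mulVec_smul,
      add_dotProduct, sub_dotProduct, smul_dotProduct, smul_eq_mul]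
    rw [dotProduct_comm _ v.ofLp, dotProduct_comm _ v.ofLp, dotProduct_comm _ v.ofLp,
      hpd.dotProduct_inv_mulVec_comm v.ofLp, hpd.dotProduct_inv_mulVec_comm v.ofLp]
    ring
  -- Here `d ≥ 2` is needed: the factor 2 in front of `log (1/δ')`, with `δ' = δ/(n+1)`, is enlarged
  -- to `d` to match the form of `β_t`.
  have hlog : Real.log ((I.gram x t).det / I.lam ^ d) +
      2 * Real.log (1 / (I.delta / ((n : ℝ) + 1))) ≤
      d * Real.log ((1 + ((t : ℝ) - 1) / I.lam) / (I.delta / ((n : ℝ) + 1))) := by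
    have hq : 0 ≤ ((t : ℝ) - 1) / I.lam := div_nonneg (by linarith) hlam.le
    have h1 := I.log_det_gram_le (by omega) hlam ht hx
    have h2 : Real.log (1 + ((t : ℝ) - 1) / (I.lam * d)) ≤
        Real.log (1 + ((t : ℝ) - 1) / I.lam) := by
      rw [← div_div]
      have h3 : ((t : ℝ) - 1) / I.lam / d ≤ ((t : ℝ) - 1) / I.lam :=
        div_le_self hq (by linarith)
      have h4 : 0 ≤ ((t : ℝ) - 1) / I.lam / d := by positivity
      exact Real.log_le_log (by linarith) (by linarith)
    have h5 : 0 ≤ Real.log (1 / (I.delta / ((n : ℝ) + 1))) := by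
      refine Real.log_nonneg ((one_le_div hδ').2 ?_)
      exact (div_le_self hδ0.le (by linarith [Nat.cast_nonneg (α := ℝ) n])).trans hδ1.le
    rw [div_eq_mul_one_div (1 + _), Real.log_mul (by positivity) (by positivity), mul_add]
    refine add_le_add (h1.trans (by gcongr)) ?_
    gcongr
  have hnoise : weightedNorm (I.gram x t)⁻¹ (noiseSum x e t) ≤
      I.rho * Real.sqrt (d * Real.log ((1 + ((t : ℝ) - 1) / I.lam) / (I.delta / ((n : ℝ) + 1)))) :=
    he.trans (mul_le_mul_of_nonneg_left (Real.sqrt_le_sqrt hlog) hρ)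
  have hreg : I.lam * weightedNorm (I.gram x t)⁻¹ a ≤ Real.sqrt I.lam * I.S := by
    have h1 := I.weightedNorm_inv_gram_le hlam x t a
    have hs := Real.sqrt_pos.2 hlam
    calc I.lam * weightedNorm (I.gram x t)⁻¹ a ≤ I.lam * (‖a‖ / Real.sqrt I.lam) := by gcongr
      _ = Real.sqrt I.lam * ‖a‖ := by
          nth_rewrite 1 [← Real.mul_self_sqrt hlam.le]
          field_simp
      _ ≤ _ := by gcongr
  rw [hdiff, width, beta]
  refine (abs_sub _ _).trans ?_
  rw [abs_mul, abs_of_pos hlam, add_mul]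
  refine add_le_add ?_ ?_
  · exact (abs_dotProduct_inv_mulVec_le hpd _ _).trans
      (mul_le_mul_of_nonneg_right hnoise (weightedNorm_nonneg _ _))
  · refine (mul_le_mul_of_nonneg_left (abs_dotProduct_inv_mulVec_le hpd a v) hlam.le).trans ?_
    rw [← mul_assoc]
    exact mul_le_mul_of_nonneg_right hreg (weightedNorm_nonneg _ _)

/-- Homogeneity is what converts the width at the optimistic point into the width at the scaled
point that is played. -/
lemma width_smul (x : ℕ → Vec d) (t : ℕ) {c : ℝ} (hc : 0 ≤ c) (v : Vec d) :
    I.width x t (c • v) = c * I.width x t v := by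
  rw [width, weightedNorm_smul _ hc, width]
  ring

variable {I} in
lemma ROFULRound.norm_le {x : ℕ → Vec d} {y : ℕ → ℝ} {z : ℕ → Vec n} {t : ℕ}
    (hball : ∀ v ∈ I.actions, ‖v‖ ≤ 1) (h : I.ROFULRound x y z t) : ‖x t‖ ≤ 1 := by
  obtain ⟨xt, μ, ⟨hxt, -⟩, ⟨⟨hμ, -⟩, -⟩, hx⟩ := h
  have h0 : 0 ≤ max (min (I.nu / ‖xt‖) 1) μ := le_max_of_le_right hμ.1
  have h1 : max (min (I.nu / ‖xt‖) 1) μ ≤ 1 := max_le (min_le_right _ _) hμ.2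
  rw [hx, norm_smul, Real.norm_of_nonneg h0]
  exact mul_le_one₀ h1 (norm_nonneg _) (hball _ hxt.1)

variable {I} in
/-- The regret of one round, when the parameters lie in the confidence sets. -/
lemma ROFULRound.inner_sub_le (hn : 1 ≤ n) (hstar : StarConvex ℝ 0 I.actions)
    (hball : ∀ v ∈ I.actions, ‖v‖ ≤ 1)
    (hG : Convex ℝ I.G) (hr : 0 < I.r) (hrG : Metric.closedBall (0 : Vec n) I.r ⊆ I.G)
    (hSA : 0 < I.SA) (hν : I.nu ≤ 1)
    (hρ : 0 ≤ I.rho) {θ : Vec d} {A : Matrix (Fin n) (Fin d) ℝ} (hθ : ‖θ‖ ≤ I.Stheta)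
    {xstar : Vec d} (hxstar : xstar ∈ I.actions) (hAxstar : matVec A xstar ∈ I.G)
    {x : ℕ → Vec d} {y : ℕ → ℝ} {z : ℕ → Vec n} {t : ℕ}
    (hconf : ∀ v, |inner ℝ (I.estimator x y t) v - inner ℝ θ v| ≤ I.width x t v)
    (hconfA : ∀ v i, |matVec (I.matEstimator x z t) v i - matVec A v i| ≤ I.width x t v)
    (h : I.ROFULRound x y z t) :
    inner ℝ θ (xstar - x t) ≤ 2 * Real.sqrt n / I.r * (I.Stheta + I.SA) *
      (I.beta t * weightedNorm (I.gram x t)⁻¹ (x t)) := by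
  obtain ⟨xt, μ, ⟨hxt, hmax⟩, ⟨⟨hμ, -⟩, hμmax⟩, hx⟩ := h
  have hw : ∀ v, 0 ≤ I.width x t v := fun v =>
    mul_nonneg (I.beta_nonneg hρ hSA t) (weightedNorm_nonneg _ _)
  have hn' : 0 < Real.sqrt n := Real.sqrt_pos.2 (by exact_mod_cast hn)
  set W := I.width x t xt with hW
  have hW0 : 0 ≤ W := hw xt
  set γ := max (min (I.nu / ‖xt‖) 1) μ with hγ
  have hγ1 : γ ≤ 1 := max_le (min_le_right _ _) hμ.2
  have hγμ : μ ≤ γ := le_max_right _ _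
  have hγ0 : 0 ≤ γ := hμ.1.trans hγμ
  have hstar_opt : xstar ∈ I.optimisticSet x z t := by
    refine ⟨hxstar, matVec A xstar, (mem_box_iff (hw xstar)).2 fun i => ?_, hAxstar⟩
    rw [abs_sub_comm]
    exact hconfA xstar i
  -- Optimism: `x_*` competes in the maximization, and passing between upper bound and true reward
  -- costs at most one width on each side at `x̃_t`.
  have hopt : inner ℝ θ (xstar - xt) ≤ 2 * W := by
    have h1 := hmax xstar hstar_opt
    have h2 := (abs_le.1 (hconf xstar)).1
    have h3 := (abs_le.1 (hconf xt)).2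
    simp only [ucb] at h1
    rw [inner_sub_right]
    linarith
  have hWγ : I.beta t * weightedNorm (I.gram x t)⁻¹ (x t) = γ * W := by
    change I.width x t (x t) = _
    rw [hx, I.width_smul x t hγ0]
  have hSθ : 0 ≤ I.Stheta := (norm_nonneg _).trans hθ
  set μ' := I.r / (I.r + 2 * Real.sqrt n * W) with hμ'
  have hden : 0 < I.r + 2 * Real.sqrt n * W := by positivity
  have hμ'0 : 0 ≤ μ' := by positivity
  have hμ'1 : μ' ≤ 1 := by
    rw [hμ', div_le_one hden]
    have : 0 ≤ 2 * Real.sqrt n * W := by positivity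
    linarith
  -- Star-convexity keeps the scaled point an action and `box_smul_subset` makes it safe, so
  -- maximality of `μ` applies.
  have hμ'γ : μ' ≤ γ := by
    refine (hμmax ⟨⟨hμ'0, hμ'1⟩, hstar.smul_mem hxt.1 hμ'0 hμ'1, ?_⟩).trans hγμ
    rw [uncertaintySet, matVec_smul, I.width_smul x t hμ'0]
    exact box_smul_subset hG hr hrG hW0 hxt.2 hμ'
  have hscale : 1 - γ ≤ 2 * Real.sqrt n / I.r * (γ * W) := by
    calc 1 - γ ≤ 1 - μ' := by linarith
      _ = 2 * Real.sqrt n / I.r * (μ' * W) := by rw [hμ']; field_simp; ring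
      _ ≤ _ := by gcongr
  have hshrink : (1 - γ) * inner ℝ θ xt ≤ 2 * Real.sqrt n / I.r * (γ * W) * I.Stheta := by
    have h1 : inner ℝ θ xt ≤ I.Stheta := by
      refine (real_inner_le_norm θ xt).trans ?_
      exact (mul_le_mul hθ (hball _ hxt.1) (norm_nonneg _) hSθ).trans (mul_one _).le
    exact (mul_le_mul_of_nonneg_left h1 (by linarith)).trans
      (mul_le_mul_of_nonneg_right hscale hSθ)
  -- The forced exploration `γ ≥ ν` trades `W` for `γW`. At `x̃_t = 0` the quotient `ν / 0` is `0`
  -- and gives no lower bound, but there `W = 0`.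
  have hνγ : W ≤ Real.sqrt n * I.SA / I.r * (γ * W) := by
    by_cases h0 : xt = 0
    · have : W = 0 := by simp [hW, h0, width, weightedNorm]
      simp [this]
    · have hxt0 : 0 < ‖xt‖ := norm_pos_iff.2 h0
      have hν0 : 0 ≤ I.nu := by unfold nu; positivity
      have h1 : I.nu ≤ γ := by
        refine le_max_of_le_left (le_min ?_ hν)
        rw [le_div_iff₀ hxt0]
        exact mul_le_of_le_one_right hν0 (hball _ hxt.1)
      have h2 : Real.sqrt n * I.SA / I.r * I.nu = 1 := by unfold nu; field_simp
      calc W = Real.sqrt n * I.SA / I.r * (I.nu * W) := by rw [← mul_assoc, h2, one_mul]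
        _ ≤ _ := by gcongr
  rw [hWγ]
  have hsplit : inner ℝ θ (xstar - x t) = inner ℝ θ (xstar - xt) + (1 - γ) * inner ℝ θ xt := by
    rw [hx]
    simp only [inner_sub_right, inner_smul_right]
    ring
  rw [hsplit]
  calc _ ≤ 2 * (Real.sqrt n * I.SA / I.r * (γ * W)) +
        2 * Real.sqrt n / I.r * (γ * W) * I.Stheta := by linarith
    _ = _ := by ring

/-- The sum of the widths of the actions played. -/
lemma sum_width_le (hd : 0 < d) (hlam : 1 ≤ I.lam) (hρ : 0 ≤ I.rho) (hSA : 0 < I.SA)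
    (hδ0 : 0 < I.delta) {x : ℕ → Vec d} {T : ℕ} (hx : ∀ k ∈ Finset.Icc 1 T, ‖x k‖ ≤ 1) :
    ∑ t ∈ Finset.Icc 1 T, I.beta t * weightedNorm (I.gram x t)⁻¹ (x t) ≤
      I.beta T * Real.sqrt (2 * d * T * Real.log (1 + T / (I.lam * d))) := by
  have h1 : ∑ t ∈ Finset.Icc 1 T, weightedNorm (I.gram x t)⁻¹ (x t) ≤
      Real.sqrt (2 * d * T * Real.log (1 + T / (I.lam * d))) := by
    refine Real.le_sqrt_of_sq_le ?_
    -- Cauchy-Schwarz over the `T` rounds, followed by the elliptical potential bound.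
    refine sq_sum_le_card_mul_sum_sq.trans ?_
    rw [Nat.card_Icc, Nat.add_sub_cancel]
    refine (mul_le_mul_of_nonneg_left (I.sum_weightedNorm_sq_le hd hlam hx)
      (Nat.cast_nonneg _)).trans (le_of_eq ?_)
    ring
  calc _ ≤ ∑ t ∈ Finset.Icc 1 T, I.beta T * weightedNorm (I.gram x t)⁻¹ (x t) := by
        refine Finset.sum_le_sum fun t ht => ?_
        rw [Finset.mem_Icc] at ht
        exact mul_le_mul_of_nonneg_right (I.beta_mono hρ (by linarith) hδ0 ht.1 ht.2)
          (weightedNorm_nonneg _ _)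
    _ ≤ _ := by
        rw [← Finset.mul_sum]
        exact mul_le_mul_of_nonneg_left h1 (I.beta_nonneg hρ hSA T)

end LearnerInput

/-! ### The regret bound. -/

theorem mainTheorem7 {d n : ℕ} (hd : 2 ≤ d) (hn : 1 ≤ n) (T : ℕ)
    -- the known data, with their standing assumptions
    (I : LearnerInput d n)
    (hclosed : IsClosed I.actions) (hstar : StarConvex ℝ 0 I.actions)
    (hball : ∀ v ∈ I.actions, ‖v‖ ≤ 1)
    (hG : Convex ℝ I.G) (hr : 0 < I.r) (hrG : Metric.closedBall (0 : Vec n) I.r ⊆ I.G)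
    (hSA : 0 < I.SA) (hSθ : 0 < I.Stheta) (hν : I.nu ≤ 1)
    (hρ : 0 ≤ I.rho) (hlam : 1 ≤ I.lam) (hδ0 : 0 < I.delta) (hδ1 : I.delta < 1)
    -- the unknown parameters and an optimal feasible action
    (θ : Vec d) (A : Matrix (Fin n) (Fin d) ℝ)
    (hθ : ‖θ‖ ≤ I.Stheta) (hA : ∀ i, ‖rowVec A i‖ ≤ I.SA)
    (xstar : Vec d) (hxstar : xstar ∈ I.actions) (hAxstar : matVec A xstar ∈ I.G)
    (hopt : ∀ v ∈ I.actions, matVec A v ∈ I.G → inner ℝ θ v ≤ inner ℝ θ xstar)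
    (hpos : 0 < inner ℝ θ xstar)
    -- the actions and the noise, as random variables
    {Ω : Type*} [MeasurableSpace Ω] (P : Measure Ω) [IsProbabilityMeasure P]
    (x : ℕ → Ω → Vec d) (ε : ℕ → Ω → ℝ) (η : ℕ → Ω → Vec n)
    (hx : ∀ t ∈ Finset.Icc 1 T, Measurable (x t))
    (hε : CondSubgaussianNoise P x ε I.rho T)
    (hη : ∀ i : Fin n, CondSubgaussianNoise P x (fun t ω => η t ω i) I.rho T)
    -- in every round the action is the one that the algorithm plays on the past observations
    (hplay : ∀ ω, ∀ t ∈ Finset.Icc 1 T,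
      I.ROFULRound (fun k => x k ω) (fun k => inner ℝ θ (x k ω) + ε k ω)
        (fun k => matVec A (x k ω) + η k ω) t) :
    ENNReal.ofReal (1 - I.delta) ≤
      P {ω | ∑ t ∈ Finset.Icc 1 T, inner ℝ θ (xstar - x t ω) ≤
        2 * Real.sqrt n / I.r * (I.Stheta + I.SA) * I.beta T *
          Real.sqrt (2 * d * T * Real.log (1 + T / (I.lam * d)))} := by
  have hlam0 : 0 < I.lam := by linarith
  have hδ' : 0 < I.delta / ((n : ℝ) + 1) := by positivity
  let Bad : (ℕ → Ω → ℝ) → Set Ω := fun e => {ω | ∃ t ∈ Finset.Icc 1 T,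
      I.rho * Real.sqrt (Real.log ((I.gram (fun k => x k ω) t).det / I.lam ^ d)
          + 2 * Real.log (1 / (I.delta / ((n : ℝ) + 1)))) <
        weightedNorm (I.gram (fun k => x k ω) t)⁻¹
          (noiseSum (fun k => x k ω) (fun k => e k ω) t)}
  -- There are `n + 1` noise sequences, the reward noise and one per row of `A`, each allotted
  -- failure probability `δ / (n + 1)`.
  have hBad : P (Bad ε ∪ ⋃ i : Fin n, Bad fun t ω => η t ω i) ≤ ENNReal.ofReal I.delta := by
    calc _ ≤ P (Bad ε) + ∑ i : Fin n, P (Bad fun t ω => η t ω i) :=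
          (measure_union_le _ _).trans (by gcongr; exact measure_iUnion_fintype_le _ _)
      _ ≤ ENNReal.ofReal (I.delta / ((n : ℝ) + 1)) +
          ∑ _i : Fin n, ENNReal.ofReal (I.delta / ((n : ℝ) + 1)) :=
          add_le_add (hε.measure_noiseSum_gt_le I hlam0 hρ hx hδ')
            (Finset.sum_le_sum fun i _ => (hη i).measure_noiseSum_gt_le I hlam0 hρ hx hδ')
      _ = ENNReal.ofReal I.delta := by
          rw [Finset.sum_const, Finset.card_univ, Fintype.card_fin, nsmul_eq_mul,
            ← ENNReal.ofReal_natCast, ← ENNReal.ofReal_mul (Nat.cast_nonneg _),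
            ← ENNReal.ofReal_add hδ'.le (by positivity)]
          congr 1
          field_simp
          ring
  have hgood : (Bad ε ∪ ⋃ i : Fin n, Bad fun t ω => η t ω i)ᶜ ⊆
      {ω | ∑ t ∈ Finset.Icc 1 T, inner ℝ θ (xstar - x t ω) ≤
        2 * Real.sqrt n / I.r * (I.Stheta + I.SA) * I.beta T *
          Real.sqrt (2 * d * T * Real.log (1 + T / (I.lam * d)))} := by
    intro ω hω
    simp only [Set.compl_union, Set.compl_iUnion, Set.mem_inter_iff, Set.mem_iInter,
      Set.mem_compl_iff, Bad, Set.mem_ofPred_eq, not_exists, not_and, not_lt] at hω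
    obtain ⟨hωε, hωη⟩ := hω
    have hnorm : ∀ t ∈ Finset.Icc 1 T, ‖x t ω‖ ≤ 1 := fun t ht =>
      (hplay ω t ht).norm_le (x := fun k => x k ω) hball
    have hround : ∀ t ∈ Finset.Icc 1 T, inner ℝ θ (xstar - x t ω) ≤
        2 * Real.sqrt n / I.r * (I.Stheta + I.SA) *
          (I.beta t * weightedNorm (I.gram (fun k => x k ω) t)⁻¹ (x t ω)) := by
      intro t ht
      have ht1 := (Finset.mem_Icc.1 ht).1
      have hnorm' : ∀ k ∈ Finset.Ico 1 t, ‖x k ω‖ ≤ 1 := fun k hk =>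
        hnorm k (by simp at hk ht ⊢; omega)
      refine (hplay ω t ht).inner_sub_le (x := fun k => x k ω) hn hstar hball hG hr hrG hSA hν hρ
        hθ hxstar hAxstar ?_ ?_
      · exact I.abs_inner_estimator_sub_le hd hlam0 hρ hδ0 hδ1 ht1 hnorm'
          (hθ.trans (le_max_right _ _)) (fun k => rfl) (hωε t ht)
      · intro v i
        rw [matVec_apply, matVec_apply]
        refine I.abs_inner_estimator_sub_le hd hlam0 hρ hδ0 hδ1 ht1 hnorm'
          ((hA i).trans (le_max_left _ _)) (e := fun k => η k ω i) (fun k => ?_) (hωη i t ht) v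
        rw [PiLp.add_apply, matVec_apply]
    calc _ ≤ ∑ t ∈ Finset.Icc 1 T, 2 * Real.sqrt n / I.r * (I.Stheta + I.SA) *
          (I.beta t * weightedNorm (I.gram (fun k => x k ω) t)⁻¹ (x t ω)) :=
          Finset.sum_le_sum hround
      _ ≤ 2 * Real.sqrt n / I.r * (I.Stheta + I.SA) *
          (I.beta T * Real.sqrt (2 * d * T * Real.log (1 + T / (I.lam * d)))) := by
          rw [← Finset.mul_sum]
          exact mul_le_mul_of_nonneg_left
            (I.sum_width_le (x := fun k => x k ω) (by omega) hlam hρ hSA hδ0 hnorm) (by positivity)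
      _ = _ := by ring
  refine le_trans ?_ (measure_mono hgood)
  rw [ENNReal.ofReal_sub _ hδ0.le, ENNReal.ofReal_one, tsub_le_iff_right]
  -- Subadditivity alone suffices, so neither the bad event nor the regret event has to be shown
  -- measurable.
  calc (1 : ENNReal) = P Set.univ := measure_univ.symm
    _ ≤ P (Bad ε ∪ ⋃ i : Fin n, Bad fun t ω => η t ω i)ᶜ +
        P (Bad ε ∪ ⋃ i : Fin n, Bad fun t ω => η t ω i) := by
        rw [← Set.compl_union_self (Bad ε ∪ ⋃ i : Fin n, Bad fun t ω => η t ω i)]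
        exact measure_union_le _ _
    _ ≤ _ := by gcongr
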